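/- \textbf{Theorem.} Let $n\ge 1$, $0<\alpha<n$ and $1<p\le q<\infty$, and write $\frac1{p'}=1-\frac1p$. A weight is a non-negative locally integrable function on $\mathbb R^n$; cubes have sides parallel to the coordinate axes and positive side length; $|Q|$ is the Lebesgue measure of $Q$; for a weight $w$ put $w(Q)=\int_Q w\,dx$ and $\langle w\rangle_Q=\frac{1}{|Q|}\int_Q w\,dx$. For $0\le\beta<n$ let $$M_\beta f(x)=\sup_{Q\ni x}|Q|^{\beta/n}\,\frac1{|Q|}\int_Q|f|\,dy ,\qquad M=M_0,$$ and for weights $u,\sigma$ let $$A^\alpha_{p,q}(u,\sigma,Q)=|Q|^{\frac{\alpha}{n}+\frac1q-\frac1p}\,\langle u\rangle_Q^{1/q}\,\langle\sigma\rangle_Q^{1/p'},\qquad A^{\exp}_\infty(\sigma,Q)=\langle\sigma\rangle_Q\,\exp\Big(-\frac1{|Q|}\int_Q\log\sigma\,dx\Big),$$ where $\log 0=-\infty$ and $0\cdot\infty=0$. All suprema below are over all cubes $Q$: $$[u,\sigma]_{A^\alpha_{p,q}}=\sup_Q A^\alpha_{p,q}(u,\sigma,Q),\qquad [u,\sigma]_{A^\alpha_{p,q}(u,\sigma)A^{\exp}_\infty(\sigma)^{1/q}}=\sup_Q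 A^\alpha_{p,q}(u,\sigma,Q)\,A^{\exp}_\infty(\sigma,Q)^{1/q},$$ $$[\sigma]_{A^{\exp}_\infty}=\sup_Q A^{\exp}_\infty(\sigma,Q),\qquad [\sigma]_{A^M_\infty}=\sup_Q\frac1{\sigma(Q)}\int_Q M(\sigma\chi_Q)\,dx$$ (with $0/0=0$). Let $\|M_\alpha(\,\cdot\,\sigma)\|_{L^p(\sigma)\to L^q(u)}$ be the least $K\in[0,\infty]$ with $\big(\int (M_\alpha(f\sigma))^q\,u\,dx\big)^{1/q}\le K\big(\int|f|^p\,\sigma\,dx\big)^{1/p}$ for all $f\in L^p(\sigma)$. Then there is a finite constant $C$, depending only on $n,\alpha,p,q$, such that for all weights $u,\sigma$ with $(u,\sigma)\in A^\alpha_{p,q}$ (that is, $[u,\sigma]_{A^\alpha_{p,q}}<\infty$) and $\sigma\in A_\infty$ (that is, $[\sigma]_{A^{\exp}_\infty}<\infty$), both $$\|M_\alpha(\,\cdot\,\sigma)\|_{L^p(\sigma)\to L^q(u)}\le C\,[u,\sigma]_{A^\alpha_{p,q}(u,\sigma)A^{\exp}_\infty(\sigma)^{1/q}}$$ and $$\|M_\alpha(\,\cdot\,\sigma)\|_{L^p(\sigma)\to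 L^q(u)}\le C\,[u,\sigma]_{A^\alpha_{p,q}}\,[\sigma]_{A^M_\infty}^{1/q}.$$ -/

import Mathlib

open MeasureTheory
open scoped ENNReal NNReal

noncomputable section

namespace TwoWeight

/-- A (nondegenerate) cube in `ℝⁿ` with sides parallel to the coordinate axes, given by its
lower corner and its side length. -/
structure Cube (n : ℕ) where
  corner : Fin n → ℝ
  side : ℝ
  side_pos : 0 < side

/-- The set of points of a cube, `∏ᵢ [aᵢ, aᵢ + ℓ)`. -/
def Cube.toSet {n : ℕ} (Q : Cube n) : Set (Fin n → ℝ) :=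
  Set.univ.pi fun i => Set.Ico (Q.corner i) (Q.corner i + Q.side)

/-- A weight: a non-negative, locally integrable function on `ℝⁿ`. -/
structure IsWeight {n : ℕ} (w : (Fin n → ℝ) → ℝ) : Prop where
  nonneg : ∀ x, 0 ≤ w x
  locallyIntegrable : LocallyIntegrable w volume

/-- The measure `w dx`. -/
def weightMeasure {n : ℕ} (w : (Fin n → ℝ) → ℝ) : Measure (Fin n → ℝ) :=
  volume.withDensity fun x => ENNReal.ofReal (w x)

/-- The average of `w ≥ 0` over the cube `Q`, as an element of `[0, ∞]`. -/
def avg {n : ℕ} (w : (Fin n → ℝ) → ℝ) (Q : Cube n) : ℝ≥0∞ :=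
  ⨍⁻ x in Q.toSet, ENNReal.ofReal (w x) ∂volume

/-- The fractional maximal function
`M_α f (x) = sup_{Q ∋ x} |Q|^{α/n} (1/|Q|) ∫_Q |f|`, with values in `[0, ∞]`. -/
def fracMaximal {n : ℕ} (α : ℝ) (f : (Fin n → ℝ) → ℝ) (x : Fin n → ℝ) : ℝ≥0∞ :=
  ⨆ (Q : Cube n) (_ : x ∈ Q.toSet),
    volume Q.toSet ^ (α / n) * ⨍⁻ y in Q.toSet, ‖f y‖ₑ ∂volume

/-- The Hardy-Littlewood maximal function `M f (x) = sup_{Q ∋ x} (1/|Q|) ∫_Q |f|`. -/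
def hlMaximal {n : ℕ} (f : (Fin n → ℝ) → ℝ) (x : Fin n → ℝ) : ℝ≥0∞ :=
  ⨆ (Q : Cube n) (_ : x ∈ Q.toSet), ⨍⁻ y in Q.toSet, ‖f y‖ₑ ∂volume

/-- The functional `A^α_{p,q}(u,σ,Q)`; here `p.conjExponent = p / (p - 1)` is `p'`. -/
def apqLocal {n : ℕ} (α p q : ℝ) (u σ : (Fin n → ℝ) → ℝ) (Q : Cube n) : ℝ≥0∞ :=
  volume Q.toSet ^ (α / n + 1 / q - 1 / p) * avg u Q ^ (1 / q) * avg σ Q ^ (1 / p.conjExponent)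

/-- The two weight constant `[u,σ]_{A^α_{p,q}}`. -/
def apqConst {n : ℕ} (α p q : ℝ) (u σ : (Fin n → ℝ) → ℝ) : ℝ≥0∞ :=
  ⨆ Q : Cube n, apqLocal α p q u σ Q

/-- The average of `log w` over `Q`, as the average of the positive part minus the average of the
negative part of `log w : ℝⁿ → [-∞, ∞]` (with `log 0 = -∞`). The first average is finite when `w`
is integrable on `Q`, so the value is then a well-defined element of `[-∞, ∞)`. -/
def avgLog {n : ℕ} (w : (Fin n → ℝ) → ℝ) (Q : Cube n) : EReal :=
  ((⨍⁻ x in Q.toSet, (ENNReal.log (ENNReal.ofReal (w x))).toENNReal ∂volume : ℝ≥0∞) : EReal) -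
    ((⨍⁻ x in Q.toSet, (-ENNReal.log (ENNReal.ofReal (w x))).toENNReal ∂volume : ℝ≥0∞) : EReal)

/-- The functional `A^exp_∞(σ,Q)`, the average of `σ` times `exp (-` average of `log σ)`. -/
def aexpLocal {n : ℕ} (σ : (Fin n → ℝ) → ℝ) (Q : Cube n) : ℝ≥0∞ :=
  avg σ Q * EReal.exp (-avgLog σ Q)

/-- The exponential constant `[σ]_{A^exp_∞}`. -/
def aexpConst {n : ℕ} (σ : (Fin n → ℝ) → ℝ) : ℝ≥0∞ :=
  ⨆ Q : Cube n, aexpLocal σ Q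

/-- The Fujii-Wilson constant `[σ]_{A^M_∞} = sup_Q (1/σ(Q)) ∫_Q M(σ χ_Q) dx`. -/
def amConst {n : ℕ} (σ : (Fin n → ℝ) → ℝ) : ℝ≥0∞ :=
  ⨆ Q : Cube n,
    (∫⁻ x in Q.toSet, hlMaximal (Q.toSet.indicator σ) x ∂volume) / weightMeasure σ Q.toSet

/-- The one-supremum constant `sup_Q A^α_{p,q}(u,σ,Q) A^exp_∞(σ,Q)^{1/q}`. -/
def mixedConst {n : ℕ} (α p q : ℝ) (u σ : (Fin n → ℝ) → ℝ) : ℝ≥0∞ :=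
  ⨆ Q : Cube n, apqLocal α p q u σ Q * aexpLocal σ Q ^ (1 / q)

/-- The pair `(u,σ)` belongs to the class `A^α_{p,q}`. -/
def MemApq {n : ℕ} (α p q : ℝ) (u σ : (Fin n → ℝ) → ℝ) : Prop :=
  apqConst α p q u σ < ∞

/-- The weight `σ` belongs to the Muckenhoupt class `A_∞`. -/
def MemAInfty {n : ℕ} (σ : (Fin n → ℝ) → ℝ) : Prop :=
  aexpConst σ < ∞

/-- The norm of `f ↦ M_α(f σ)` from `L^p(σ)` to `L^q(u)`: the smallest `K ∈ [0, ∞]` such that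
`‖M_α(f σ)‖_{L^q(u)} ≤ K ‖f‖_{L^p(σ)}` for all `f ∈ L^p(σ)`. -/
def fracMaximalNorm {n : ℕ} (α p q : ℝ) (u σ : (Fin n → ℝ) → ℝ) : ℝ≥0∞ :=
  sInf {K : ℝ≥0∞ | ∀ f : (Fin n → ℝ) → ℝ, MemLp f (ENNReal.ofReal p) (weightMeasure σ) →
    eLpNorm (fracMaximal α fun x => f x * σ x) (ENNReal.ofReal q) (weightMeasure u) ≤
      K * eLpNorm f (ENNReal.ofReal p) (weightMeasure σ)}

end TwoWeight

end

/-!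
The maximal function is reduced to a sum over dyadic cubes, and the two constants enter through two
different choices of Carleson weights for one and the same sum.

By the one-third trick (`exists_gridCube_subset`) every cube lies in a cube of comparable size of
one of `2 ^ n` shifted dyadic grids, so it suffices to bound the dyadic fractional maximal functions
of these grids, restricted to generations bounded from below; monotone convergence removes this
restriction (`lintegral_fracMaximal_rpow_le`). A grid truncated in this way is a sequence of nested
countable partitions, and the core of the argument takes place in that generality
(`CellFiltration`).

Write `V` for the fractional averages of `f σ`. A cell is principal if `V` there exceeds twice its
value at the last principal ancestor. Then `(sup V) ^ q` is at most `2 ^ q` times the sum of `V ^ q`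
over the principal cells. The principal cells satisfy a Carleson condition with respect to Lebesgue
measure (`CellFiltration.tsum_lintegral_stopInd_le`), because the ratio of `V` to its last principal
value, in expectation, pays for each new principal cell. With `X` the `σ`-average of `|f|` over `Q`,
the `Q`-term `V ^ q u(Q)` equals `A(u, σ, Q) ^ q (X ^ p σ(Q)) ^ (q / p)`
(`fracAvg_rpow_mul_eq`), and since `X ^ p σ(Q) ≤ ‖f‖ ^ p` and `p ≤ q`, one factor `X ^ p σ(Q)` can
be kept and the remaining power replaced by `‖f‖ ^ (q - p)`.

In the sum `∑ A(u, σ, Q) ^ q X ^ p σ(Q)` the weights are now split as a constant times `c Q |Q|`: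

* for the bound with one supremum, `c Q = exp ⟨log σ⟩_Q`, as `σ(Q) = A^exp(σ, Q) · c Q |Q|`;
* for the bound with two suprema, `c Q = ⟨σ⟩_Q`, so that `c Q |Q| = σ(Q)`.

The Carleson embedding `CellFiltration.tsum_lintegral_mul_le`, applied to Lebesgue measure on a cell
`R`, shows that the sum of `c Q |Q|` over principal `Q ⊆ R` is at most three times the integral over
`R` of the maximal function of `c`. In the first case this is at most `4 σ(R)`, by Jensen's
inequality `c Q ≤ ⟨σ ^ (1 / 2)⟩_Q ^ 2` (`exp_avgLog_le`) and Doob's inequality in `L ^ 2`. In the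
second case it is at most `[σ]_{A^M} σ(R)` by definition. The embedding, applied once more with
respect to `σ`, followed by Doob's inequality in `L ^ p(σ)`
(`CellFiltration.lintegral_iSup_cellAvg_rpow_le`), bounds the sum of `X ^ p c Q |Q|` by
a multiple of `‖f‖ ^ p`.
-/

namespace TwoWeight

/-! ### Nested countable partitions -/

/-- A sequence of nested partitions of `X` into measurable cells: the cells of generation `m` are
the nonempty fibres of the labelling `index m`, and the partition of generation `m + 1` refines
that of generation `m`. -/
structure CellFiltration (X ι : Type*) [MeasurableSpace X] [MeasurableSpace ι] where
  index : ℕ → X → ι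
  measurable_index : ∀ m, Measurable (index m)
  nested : ∀ m x y, index (m + 1) x = index (m + 1) y → index m x = index m y

namespace CellFiltration

variable {X ι : Type*} [MeasurableSpace X] [MeasurableSpace ι]
  (T : CellFiltration X ι) {μ ν : Measure X} {m : ℕ}

/-- The cell of generation `m` that contains `x`. -/
def cell (m : ℕ) (x : X) : Set X := T.index m ⁻¹' {T.index m x}

/-- The filtration whose generation `m` is the generation `j + m` of `T`. -/
def shift (j : ℕ) : CellFiltration X ι where
  index m := T.index (j + m)
  measurable_index m := T.measurable_index (j + m)
  nested m x y h := T.nested (j + m) x y h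

/-- A function is adapted to generation `m` if it is constant on the cells of generation `m`. -/
def Adapted {β : Type*} (m : ℕ) (h : X → β) : Prop := Function.FactorsThrough h (T.index m)

/-- The average of `F` over the cell of generation `m` that contains `x`, with respect to `ν`.
It is `0` when that cell is a null set. -/
noncomputable def cellAvg (ν : Measure X) (F : X → ℝ≥0∞) (m : ℕ) (x : X) : ℝ≥0∞ :=
  (∫⁻ y in T.cell m x, F y ∂ν) / ν (T.cell m x)

variable {T}

theorem cell_eq {x y : X} (h : y ∈ T.cell m x) : T.cell m y = T.cell m x := by
  have : T.index m y = T.index m x := h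
  simp [cell, this]

theorem index_eq_of_le {j m : ℕ} (hjm : j ≤ m) {x y : X} (h : T.index m x = T.index m y) :
    T.index j x = T.index j y := by
  induction m, hjm using Nat.le_induction with
  | base => exact h
  | succ k _ ih => exact ih (T.nested _ _ _ h)

theorem cell_subset {j m : ℕ} (hjm : j ≤ m) (x : X) : T.cell m x ⊆ T.cell j x :=
  fun _ hy => index_eq_of_le hjm hy

theorem Adapted.mono {β : Type*} {j m : ℕ} (hjm : j ≤ m) {h : X → β} (hh : T.Adapted j h) :
    T.Adapted m h := fun _ _ hxy => hh (index_eq_of_le hjm hxy)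

theorem Adapted.comp₂ {β γ δ : Type*} {h : X → β} {k : X → γ} (hh : T.Adapted m h)
    (hk : T.Adapted m k) (φ : β → γ → δ) : T.Adapted m fun x => φ (h x) (k x) :=
  fun x y hxy => by simp only [hh hxy, hk hxy]

theorem Adapted.comp {β γ : Type*} {h : X → β} (hh : T.Adapted m h) (φ : β → γ) :
    T.Adapted m fun x => φ (h x) :=
  fun x y hxy => by simp only [hh hxy]

theorem adapted_const {β : Type*} (b : β) : T.Adapted m fun _ => b := fun _ _ _ => rfl

theorem adapted_cell (m : ℕ) : T.Adapted m (T.cell m) := fun x y h => by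
  simp [cell, show T.index m x = T.index m y from h]

theorem adapted_cellAvg (ν : Measure X) (F : X → ℝ≥0∞) (m : ℕ) :
    T.Adapted m (T.cellAvg ν F m) := fun x y h => by
  simp only [cellAvg, adapted_cell m h]

theorem adapted_partialSups {g : ℕ → X → ℝ≥0∞} (hg : ∀ m, T.Adapted m (g m)) (m : ℕ) :
    T.Adapted m (partialSups g m) := by
  induction m with
  | zero => simpa using hg 0
  | succ k ih =>
    rw [← Order.succ_eq_add_one, partialSups_succ]
    exact (ih.mono k.le_succ).comp₂ (hg _) max

/-- Jensen's inequality for the power `p` on a cell. -/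
theorem cellAvg_rpow_mul_le {p : ℝ} (hp : 1 < p) {F : X → ℝ≥0∞} (hF : AEMeasurable F ν)
    (hfin : ∀ x, ν (T.cell m x) ≠ ∞) (x : X) :
    T.cellAvg ν F m x ^ p * ν (T.cell m x) ≤ ∫⁻ y in T.cell m x, F y ^ p ∂ν := by
  by_cases h0 : ν (T.cell m x) = 0
  · simp [h0]
  have hpq := Real.HolderConjugate.conjExponent hp
  have hH := ENNReal.lintegral_mul_le_Lp_mul_Lq (ν.restrict (T.cell m x)) hpq hF.restrict
    (aemeasurable_const (b := (1 : ℝ≥0∞)))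
  simp only [Pi.mul_apply, mul_one, ENNReal.one_rpow, lintegral_const, Measure.restrict_apply,
    MeasurableSet.univ, Set.univ_inter, one_mul] at hH
  have hp0 : 0 < p := by linarith
  have h1 := ENNReal.rpow_le_rpow hH hp0.le
  rw [ENNReal.mul_rpow_of_nonneg _ _ hp0.le, ← ENNReal.rpow_mul, ← ENNReal.rpow_mul,
    one_div_mul_cancel hp0.ne', ENNReal.rpow_one] at h1
  have he : 1 / p.conjExponent * p = p - 1 := by
    have := hpq.inv_add_inv_eq_one
    rw [one_div, show (p.conjExponent)⁻¹ = 1 - p⁻¹ by linarith]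
    field_simp
  rw [he] at h1
  rw [cellAvg, ENNReal.div_rpow_of_nonneg _ _ hp0.le]
  calc _ ≤ (∫⁻ y in T.cell m x, F y ^ p ∂ν) * ν (T.cell m x) ^ (p - 1) /
        ν (T.cell m x) ^ p * ν (T.cell m x) := by gcongr
    _ = _ := by
      rw [div_eq_mul_inv, ← ENNReal.rpow_neg, mul_assoc, mul_assoc]
      nth_rw 3 [← ENNReal.rpow_one (ν (T.cell m x))]
      rw [← ENNReal.rpow_add _ _ h0 (hfin x), ← ENNReal.rpow_add _ _ h0 (hfin x)]
      simp

theorem cellAvg_ne_top {p : ℝ} (hp : 1 < p) {F : X → ℝ≥0∞} (hF : AEMeasurable F ν)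
    (hfin : ∀ x, ν (T.cell m x) ≠ ∞) (hFp : ∫⁻ x, F x ^ p ∂ν ≠ ∞) (x : X) :
    T.cellAvg ν F m x ≠ ∞ := by
  by_cases h0 : ν (T.cell m x) = 0
  · simp [cellAvg, h0, setLIntegral_measure_zero]
  intro htop
  have h := cellAvg_rpow_mul_le hp hF hfin x
  rw [htop, ENNReal.top_rpow_of_pos (by linarith), ENNReal.top_mul h0] at h
  exact hFp (top_le_iff.mp (h.trans (setLIntegral_le_lintegral _ _)))

variable [MeasurableSingletonClass ι]

theorem measurableSet_cell (m : ℕ) (x : X) : MeasurableSet (T.cell m x) :=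
  T.measurable_index m (measurableSet_singleton _)

theorem setLIntegral_adapted_mul {h φ : X → ℝ≥0∞} (hh : T.Adapted m h) (hφ : AEMeasurable φ μ)
    (x : X) : ∫⁻ y in T.cell m x, h y * φ y ∂μ = h x * ∫⁻ y in T.cell m x, φ y ∂μ := by
  rw [← lintegral_const_mul'' _ hφ.restrict]
  refine setLIntegral_congr_fun (measurableSet_cell m x) fun y hy => ?_
  rw [hh hy]

theorem setLIntegral_adapted {h : X → ℝ≥0∞} (hh : T.Adapted m h) (x : X) :
    ∫⁻ y in T.cell m x, h y ∂μ = h x * μ (T.cell m x) := by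
  simpa using setLIntegral_adapted_mul (μ := μ) (φ := fun _ => 1) hh aemeasurable_const x

theorem setLIntegral_cellAvg {F : X → ℝ≥0∞} (hfin : ∀ x, ν (T.cell m x) ≠ ∞) (x : X) :
    ∫⁻ y in T.cell m x, T.cellAvg ν F m y ∂ν = ∫⁻ y in T.cell m x, F y ∂ν := by
  rw [setLIntegral_adapted (adapted_cellAvg ν F m), cellAvg]
  by_cases h0 : ν (T.cell m x) = 0
  · simp [h0, setLIntegral_measure_zero]
  · exact ENNReal.div_mul_cancel h0 (hfin x)

variable [Countable ι]

theorem Adapted.measurable {h : X → ℝ≥0∞} (hh : T.Adapted m h) : Measurable h := by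
  have : h = Function.extend (T.index m) h 0 ∘ T.index m := by
    funext x; exact (Function.FactorsThrough.extend_apply hh 0 x).symm
  rw [this]
  exact (measurable_of_countable _).comp (T.measurable_index m)

theorem lintegral_eq_tsum_cell (m : ℕ) (μ : Measure X) (φ : X → ℝ≥0∞) :
    ∫⁻ x, φ x ∂μ = ∑' i, ∫⁻ x in T.index m ⁻¹' {i}, φ x ∂μ := by
  rw [← lintegral_iUnion (fun i => T.measurable_index m (measurableSet_singleton i)),
    ← Set.preimage_iUnion, Set.iUnion_of_singleton, Set.preimage_univ, Measure.restrict_univ]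
  intro i j hij
  exact Disjoint.preimage _ (by simpa using hij)

/-- Two integrands, possibly against different measures, may be compared cell by cell, also after
multiplication with a function that is constant on cells. -/
theorem lintegral_mul_le_of_cell {φ ψ h : X → ℝ≥0∞} (hφ : AEMeasurable φ μ)
    (hψ : AEMeasurable ψ ν) (hh : T.Adapted m h)
    (hle : ∀ x, ∫⁻ y in T.cell m x, φ y ∂μ ≤ ∫⁻ y in T.cell m x, ψ y ∂ν) :
    ∫⁻ x, h x * φ x ∂μ ≤ ∫⁻ x, h x * ψ x ∂ν := by
  rw [lintegral_eq_tsum_cell (T := T) m, lintegral_eq_tsum_cell (T := T) m]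
  refine ENNReal.tsum_le_tsum fun i => ?_
  by_cases hi : ∃ x, T.index m x = i
  · obtain ⟨x, rfl⟩ := hi
    have := setLIntegral_adapted_mul hh hφ x
    have h' := setLIntegral_adapted_mul hh hψ x
    simp only [cell] at this h'
    rw [this, h']
    exact mul_le_mul_right (hle x) _
  · have : T.index m ⁻¹' {i} = ∅ := by
      ext x; simpa using fun hx => hi ⟨x, hx⟩
    simp [this]

theorem lintegral_mul_cellAvg {F h : X → ℝ≥0∞} (hF : AEMeasurable F ν)
    (hfin : ∀ x, ν (T.cell m x) ≠ ∞) (hh : T.Adapted m h) :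
    ∫⁻ x, h x * T.cellAvg ν F m x ∂ν = ∫⁻ x, h x * F x ∂ν := by
  have hm := (adapted_cellAvg (T := T) ν F m).measurable.aemeasurable (μ := ν)
  exact le_antisymm
    (lintegral_mul_le_of_cell hm hF hh fun x => (setLIntegral_cellAvg hfin x).le)
    (lintegral_mul_le_of_cell hF hm hh fun x => (setLIntegral_cellAvg hfin x).ge)

end CellFiltration

/-! ### Doob's maximal inequality -/

/-- The convexity inequality `x ^ p - y ^ p ≤ p' x (x ^ (p - 1) - y ^ (p - 1))`, written without
subtraction on the left. -/
theorem rpow_le_rpow_add_conjExponent_mul {p : ℝ} (hp : 1 < p) {x y : ℝ≥0∞} (hyx : y ≤ x)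
    (hx : x ≠ ∞) :
    x ^ p ≤ y ^ p + ENNReal.ofReal p.conjExponent * (x * (x ^ (p - 1) - y ^ (p - 1))) := by
  have hpq := Real.HolderConjugate.conjExponent hp
  have hp1 : 0 < p - 1 := by linarith
  have hy : y ≠ ∞ := ne_top_of_le_ne_top hx hyx
  lift x to ℝ≥0 using hx
  lift y to ℝ≥0 using hy
  have hyx' : y ≤ x := by exact_mod_cast hyx
  have hle : (y : ℝ≥0) ^ (p - 1) ≤ x ^ (p - 1) := NNReal.rpow_le_rpow hyx' hp1.le
  rw [← ENNReal.coe_rpow_of_nonneg _ (by linarith), ← ENNReal.coe_rpow_of_nonneg _ (by linarith),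
    ← ENNReal.coe_rpow_of_nonneg _ hp1.le, ← ENNReal.coe_rpow_of_nonneg _ hp1.le,
    ← ENNReal.coe_sub, ENNReal.ofReal]
  norm_cast
  rw [← NNReal.coe_le_coe]
  push_cast [NNReal.coe_sub hle]
  rw [Real.coe_toNNReal _ hpq.symm.nonneg]
  have hy0 := y.coe_nonneg
  have hx0 := x.coe_nonneg
  have young := Real.young_inequality_of_nonneg hx0 (Real.rpow_nonneg hy0 (p - 1)) hpq
  have e1 : ((y : ℝ) ^ (p - 1)) ^ p.conjExponent = (y : ℝ) ^ p := by
    rw [← Real.rpow_mul hy0]; congr 1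
    rw [Real.conjExponent]; field_simp
  have e2 : (x : ℝ) * (x : ℝ) ^ (p - 1) = (x : ℝ) ^ p := by
    rw [← Real.rpow_one_add' hx0 (by linarith)]; ring_nf
  rw [e1] at young
  rw [mul_sub, e2]
  have hc : p.conjExponent = p / (p - 1) := rfl
  rw [hc] at young ⊢
  set a := (x : ℝ) ^ p
  set b := (y : ℝ) ^ p
  set z := (x : ℝ) * (y : ℝ) ^ (p - 1)
  have : p / (p - 1) * (a - z) - (a - b) = p / (p - 1) * (a / p + b / (p / (p - 1)) - z) := by
    field_simp; ring
  have h2 : 0 ≤ p / (p - 1) * (a / p + b / (p / (p - 1)) - z) :=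
    mul_nonneg (by positivity) (by linarith)
  linarith

theorem iSup_rpow {κ : Sort*} {p : ℝ} (hp : 0 < p) (f : κ → ℝ≥0∞) :
    (⨆ i, f i) ^ p = ⨆ i, f i ^ p :=
  (ENNReal.orderIsoRpow p hp).map_iSup f

namespace CellFiltration

variable {X ι : Type*} [MeasurableSpace X] [MeasurableSpace ι]
  {T : CellFiltration X ι} {μ ν : Measure X} {m : ℕ} [Countable ι] [MeasurableSingletonClass ι]

theorem lintegral_cellAvg_rpow_le {p : ℝ} (hp : 1 < p) {F : X → ℝ≥0∞} (hF : AEMeasurable F ν)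
    (hfin : ∀ x, ν (T.cell m x) ≠ ∞) :
    ∫⁻ x, T.cellAvg ν F m x ^ p ∂ν ≤ ∫⁻ x, F x ^ p ∂ν := by
  have had := (adapted_cellAvg (T := T) ν F m).comp (· ^ p)
  have := lintegral_mul_le_of_cell (T := T) (m := m) (h := fun _ => 1) (μ := ν) (ν := ν)
    (had.measurable.aemeasurable)
    (hF.pow_const p) (adapted_const 1) (fun x => by
      rw [setLIntegral_adapted had]; exact cellAvg_rpow_mul_le hp hF hfin x)
  simpa using this

/-- The running maximum `G` of the averages satisfies `∫ G ^ p ≤ p' ∫ F G ^ (p - 1)`: the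
increments of `G ^ (p - 1)` are adapted and live where `G` equals the current average, which may
therefore be replaced by `F` under the integral. -/
theorem lintegral_partialSups_cellAvg_rpow_le {p : ℝ} (hp : 1 < p) {F : X → ℝ≥0∞}
    (hF : AEMeasurable F ν) (hfin : ∀ m x, ν (T.cell m x) ≠ ∞)
    (hFp : ∫⁻ x, F x ^ p ∂ν ≠ ∞) (m : ℕ) :
    ∫⁻ x, partialSups (T.cellAvg ν F) m x ^ p ∂ν ≤
      ENNReal.ofReal p.conjExponent *
        ∫⁻ x, F x * partialSups (T.cellAvg ν F) m x ^ (p - 1) ∂ν := by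
  have hpq := Real.HolderConjugate.conjExponent hp
  set G := partialSups (T.cellAvg ν F) with hG
  have hGa : ∀ m, T.Adapted m (G m) := adapted_partialSups (adapted_cellAvg ν F)
  induction m with
  | zero =>
    have e : ∀ x, G 0 x ^ p = G 0 x ^ (p - 1) * T.cellAvg ν F 0 x := fun x => by
      have : G 0 x = T.cellAvg ν F 0 x := by simp [hG]
      rw [this]
      have := ENNReal.rpow_add_of_nonneg (x := T.cellAvg ν F 0 x) (p - 1) 1 (by linarith)
        zero_le_one
      rwa [ENNReal.rpow_one, sub_add_cancel] at this
    simp_rw [e]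
    rw [lintegral_mul_cellAvg hF (hfin 0) ((hGa 0).comp (· ^ (p - 1)))]
    simp_rw [mul_comm (F _)]
    refine le_mul_of_one_le_left' ?_
    rw [ENNReal.one_le_ofReal]
    exact hpq.symm.lt.le
  | succ k ih =>
    have hstep : G (k + 1) = G k ⊔ T.cellAvg ν F (k + 1) := by
      rw [hG, ← Order.succ_eq_add_one, partialSups_succ]
    set d : X → ℝ≥0∞ := fun x => G (k + 1) x ^ (p - 1) - G k x ^ (p - 1) with hd
    have hda : T.Adapted (k + 1) d :=
      ((hGa (k + 1)).comp₂ ((hGa k).mono k.le_succ) fun a b => a ^ (p - 1) - b ^ (p - 1))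
    have hfinG : ∀ m x, G m x ≠ ∞ := by
      intro m x
      induction m with
      | zero => simpa [hG] using cellAvg_ne_top hp hF (hfin 0) hFp x
      | succ l ihl =>
        rw [hG, ← Order.succ_eq_add_one, partialSups_succ]
        exact ne_of_lt (sup_lt_iff.mpr ⟨lt_top_iff_ne_top.mpr ihl,
          lt_top_iff_ne_top.mpr (cellAvg_ne_top hp hF (hfin _) hFp x)⟩)
    have hle : ∀ x, G k x ≤ G (k + 1) x := fun x => by rw [hstep]; exact le_sup_left
    have hpt : ∀ x, G (k + 1) x ^ p ≤
        G k x ^ p + ENNReal.ofReal p.conjExponent * (d x * T.cellAvg ν F (k + 1) x) := by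
      intro x
      rcases le_total (T.cellAvg ν F (k + 1) x) (G k x) with h | h
      · have : G (k + 1) x = G k x := by rw [hstep]; simpa using h
        rw [this]; exact le_self_add
      · have : G (k + 1) x = T.cellAvg ν F (k + 1) x := by rw [hstep]; simpa using h
        have h2 := rpow_le_rpow_add_conjExponent_mul hp (hle x) (hfinG _ x)
        rw [mul_comm (d x), ← this]
        exact h2
    have hmd : Measurable d := hda.measurable
    calc ∫⁻ x, G (k + 1) x ^ p ∂ν
        ≤ ∫⁻ x, (G k x ^ p +
            ENNReal.ofReal p.conjExponent * (d x * T.cellAvg ν F (k + 1) x)) ∂ν :=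
          lintegral_mono hpt
      _ = ∫⁻ x, G k x ^ p ∂ν + ENNReal.ofReal p.conjExponent * ∫⁻ x, d x * F x ∂ν := by
          rw [lintegral_add_left ((hGa k).measurable.pow_const p), lintegral_const_mul' _ _
            ENNReal.ofReal_ne_top, lintegral_mul_cellAvg hF (hfin _) hda]
      _ ≤ ENNReal.ofReal p.conjExponent * ∫⁻ x, F x * G k x ^ (p - 1) ∂ν +
            ENNReal.ofReal p.conjExponent * ∫⁻ x, d x * F x ∂ν := by gcongr
      _ = ENNReal.ofReal p.conjExponent * ∫⁻ x, F x * G (k + 1) x ^ (p - 1) ∂ν := by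
          rw [← mul_add, ← lintegral_add_right' (fun x => F x * G k x ^ (p - 1))
            (g := fun x => d x * F x) (hmd.aemeasurable.mul hF)]
          congr 1
          refine lintegral_congr fun x => ?_
          rw [mul_comm (d x), ← mul_add, hd, add_tsub_cancel_of_le]
          exact ENNReal.rpow_le_rpow (hle x) (by linarith)

/-- Doob's maximal inequality in `L ^ p`, for averages over cells. -/
theorem lintegral_iSup_cellAvg_rpow_le {p : ℝ} (hp : 1 < p) {F : X → ℝ≥0∞}
    (hF : AEMeasurable F ν) (hfin : ∀ m x, ν (T.cell m x) ≠ ∞) :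
    ∫⁻ x, (⨆ m, T.cellAvg ν F m x) ^ p ∂ν ≤
      ENNReal.ofReal p.conjExponent ^ p * ∫⁻ x, F x ^ p ∂ν := by
  have hpq := Real.HolderConjugate.conjExponent hp
  have hp0 : 0 < p := by linarith
  have hc0 : ENNReal.ofReal p.conjExponent ^ p ≠ 0 := by
    simp [ENNReal.rpow_eq_zero_iff, hpq.symm.pos, hp0.not_gt]
  by_cases hFp : ∫⁻ x, F x ^ p ∂ν = ∞
  · rw [hFp, ENNReal.mul_top hc0]; exact le_top
  set G := partialSups (T.cellAvg ν F) with hG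
  have hGa : ∀ m, T.Adapted m (G m) := adapted_partialSups (adapted_cellAvg ν F)
  have hbd : ∀ m, ∫⁻ x, G m x ^ p ∂ν ≤
      ENNReal.ofReal p.conjExponent ^ p * ∫⁻ x, F x ^ p ∂ν := by
    intro m
    -- finiteness is needed to divide by a power of `∫ G ^ p` below
    have hfinite : ∫⁻ x, G m x ^ p ∂ν ≠ ∞ := by
      induction m with
      | zero =>
        simpa [hG] using ne_top_of_le_ne_top hFp (lintegral_cellAvg_rpow_le hp hF (hfin 0))
      | succ k ih =>
        have hle : ∀ x, G (k + 1) x ^ p ≤ G k x ^ p + T.cellAvg ν F (k + 1) x ^ p := by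
          intro x
          rw [hG, ← Order.succ_eq_add_one, partialSups_succ, Pi.sup_apply,
            (ENNReal.monotone_rpow_of_nonneg hp0.le).map_sup]
          exact sup_le le_self_add le_add_self
        refine ne_top_of_le_ne_top (ENNReal.add_ne_top.mpr ⟨ih, ne_top_of_le_ne_top hFp
          (lintegral_cellAvg_rpow_le hp hF (hfin (k + 1)))⟩) ((lintegral_mono hle).trans ?_)
        rw [lintegral_add_left ((hGa k).measurable.pow_const p)]
    have h1 := lintegral_partialSups_cellAvg_rpow_le hp hF hfin hFp m
    have hH := ENNReal.lintegral_mul_le_Lp_mul_Lq ν hpq hF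
      ((hGa m).measurable.pow_const (p - 1)).aemeasurable
    have e1 : ∀ x, (G m x ^ (p - 1)) ^ p.conjExponent = G m x ^ p := fun x => by
      rw [← ENNReal.rpow_mul]; congr 1
      have : p - 1 ≠ 0 := by linarith
      rw [Real.conjExponent]; field_simp
    simp only [Pi.mul_apply, e1] at hH
    set Y := ∫⁻ x, G m x ^ p ∂ν with hY
    set Φ := ∫⁻ x, F x ^ p ∂ν with hΦ
    have h2 : Y ≤ ENNReal.ofReal p.conjExponent * (Φ ^ (1 / p) * Y ^ (1 / p.conjExponent)) :=
      h1.trans (mul_le_mul_right hH _)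
    by_cases hY0 : Y = 0
    · rw [hY0]; exact zero_le
    have h3 : Y ^ (1 / p) ≤ ENNReal.ofReal p.conjExponent * Φ ^ (1 / p) := by
      have hYq0 : Y ^ (1 / p.conjExponent) ≠ 0 := by
        simp [ENNReal.rpow_eq_zero_iff, hY0, hfinite]
      have hYqt : Y ^ (1 / p.conjExponent) ≠ ∞ := by
        simp [ENNReal.rpow_eq_top_iff, hY0, hfinite]
      refine (ENNReal.mul_le_mul_iff_left hYq0 hYqt).mp ?_
      rw [← ENNReal.rpow_add _ _ hY0 hfinite, one_div, one_div, hpq.inv_add_inv_eq_one,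
        ENNReal.rpow_one, mul_assoc, ← one_div, ← one_div]
      exact h2
    have h4 := ENNReal.rpow_le_rpow h3 hp0.le
    rwa [ENNReal.mul_rpow_of_nonneg _ _ hp0.le, ← ENNReal.rpow_mul, ← ENNReal.rpow_mul,
      one_div_mul_cancel hp0.ne', ENNReal.rpow_one, ENNReal.rpow_one] at h4
  have hsup : ∀ x, (⨆ m, T.cellAvg ν F m x) ^ p = ⨆ m, G m x ^ p := by
    intro x
    rw [← iSup_rpow hp0]
    congr 1
    have := congrFun (iSup_partialSups_eq (T.cellAvg ν F)) x
    simp only [iSup_apply] at this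
    exact this.symm
  simp_rw [hsup]
  rw [lintegral_iSup (fun m => (hGa m).measurable.pow_const p)]
  · exact iSup_le hbd
  · intro i j hij x
    exact ENNReal.rpow_le_rpow (G.monotone hij x) hp0.le

/-! ### The Carleson embedding -/

/-- A running maximum is the sum of its increments. -/
theorem sum_partialSups_sub (g : ℕ → ℝ≥0∞) (m : ℕ) :
    ∑ j ∈ Finset.range m, (partialSups g (j + 1) - partialSups g j) + g 0 = partialSups g m := by
  induction m with
  | zero => simp
  | succ k ih =>
    rw [Finset.sum_range_succ, add_right_comm, ih,
      add_tsub_cancel_of_le ((partialSups g).monotone k.le_succ)]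

theorem tsum_sum_range_succ_eq (a : ℕ → ℕ → ℝ≥0∞) :
    ∑' m, ∑ j ∈ Finset.range (m + 1), a j m = ∑' j, ∑' m, a j (j + m) := by
  have h1 : ∀ m, ∑ j ∈ Finset.range (m + 1), a j m = ∑' j, if j ≤ m then a j m else 0 := by
    intro m
    rw [tsum_eq_sum (s := Finset.range (m + 1))]
    · refine Finset.sum_congr rfl fun j hj => ?_
      rw [if_pos (Nat.lt_succ_iff.mp (Finset.mem_range.mp hj))]
    · intro j hj
      rw [if_neg fun h => hj (Finset.mem_range.mpr (Nat.lt_succ_of_le h))]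
  have h2 : ∀ j, ∑' m, (if j ≤ m then a j m else 0) = ∑' m, a j (j + m) := by
    intro j
    rw [← Summable.sum_add_tsum_nat_add' (k := j) ENNReal.summable, Finset.sum_eq_zero, zero_add]
    · refine tsum_congr fun m => ?_
      rw [if_pos (Nat.le_add_left j m), add_comm]
    · intro m hm
      rw [if_neg (not_le.mpr (Finset.mem_range.mp hm))]
  simp_rw [h1]
  rw [ENNReal.tsum_comm]
  exact tsum_congr h2

/-- The Carleson embedding: if the weights `c m` satisfy a Carleson condition with respect to `σ`,
tested on all nonnegative functions `h` adapted to some generation `j`, then sums against `c` are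
controlled by the integral of the maximal function. -/
theorem tsum_lintegral_mul_le {A : ℝ≥0∞} {c g : ℕ → X → ℝ≥0∞} (hc : ∀ m, Measurable (c m))
    (hg : ∀ m, T.Adapted m (g m))
    (hcar : ∀ j (h : X → ℝ≥0∞), T.Adapted j h →
      ∑' m, ∫⁻ x, h x * c (j + m) x ∂μ ≤ A * ∫⁻ x, h x ∂ν) :
    ∑' m, ∫⁻ x, g m x * c m x ∂μ ≤ A * ∫⁻ x, ⨆ m, g m x ∂ν := by
  set G := partialSups g with hG
  have hGa : ∀ m, T.Adapted m (G m) := adapted_partialSups hg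
  -- the increments of the running maximum
  obtain ⟨d, hda, hsum⟩ : ∃ d : ℕ → X → ℝ≥0∞, (∀ j, T.Adapted j (d j)) ∧
      ∀ m x, ∑ j ∈ Finset.range (m + 1), d j x = G m x := by
    refine ⟨fun j => Nat.casesOn j (g 0) fun i x => G (i + 1) x - G i x, ?_, ?_⟩
    · intro j
      cases j with
      | zero => exact hg 0
      | succ i => exact (hGa (i + 1)).comp₂ ((hGa i).mono i.le_succ) (· - ·)
    · intro m x
      rw [Finset.sum_range_succ']
      have := sum_partialSups_sub (fun m => g m x) m
      simp only [← Pi.partialSups_apply] at this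
      exact this
  have hle : ∀ m x, g m x ≤ G m x := fun m x => le_partialSups g m x
  have hsup : ∀ x, ∑' j, d j x ≤ ⨆ m, g m x := by
    intro x
    rw [ENNReal.tsum_eq_iSup_nat]
    refine iSup_le fun m => ?_
    refine (Finset.sum_le_sum_of_subset (Finset.range_mono m.le_succ)).trans ?_
    rw [hsum, hG, Pi.partialSups_apply]
    exact partialSups_le _ _ _ fun i _ => le_iSup (fun m => g m x) i
  calc ∑' m, ∫⁻ x, g m x * c m x ∂μ
      ≤ ∑' m, ∫⁻ x, ∑ j ∈ Finset.range (m + 1), d j x * c m x ∂μ := by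
        refine ENNReal.tsum_le_tsum fun m => lintegral_mono fun x => ?_
        rw [← Finset.sum_mul, hsum]
        exact mul_le_mul_left (hle m x) _
    _ = ∑' j, ∑' m, ∫⁻ x, d j x * c (j + m) x ∂μ := by
        rw [← tsum_sum_range_succ_eq fun j m => ∫⁻ x, d j x * c m x ∂μ]
        exact tsum_congr fun m =>
          lintegral_finsetSum _ fun j _ => (hda j).measurable.fun_mul (hc m)
    _ ≤ ∑' j, A * ∫⁻ x, d j x ∂ν := ENNReal.tsum_le_tsum fun j => hcar j _ (hda j)
    _ = A * ∫⁻ x, ∑' j, d j x ∂ν := by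
        rw [ENNReal.tsum_mul_left, lintegral_tsum fun j => (hda j).measurable.aemeasurable]
    _ ≤ A * ∫⁻ x, ⨆ m, g m x ∂ν := mul_le_mul_right (lintegral_mono hsup) _

end CellFiltration

/-! ### Principal cells -/

section StoppingTime

variable {X : Type*}

/-- The value of `V` at the last principal generation: it is updated when the current value is
more than twice the stored one. -/
noncomputable def stopValue (V : ℕ → X → ℝ≥0∞) : ℕ → X → ℝ≥0∞
  | 0 => V 0
  | m + 1 => fun x => if 2 * stopValue V m x < V (m + 1) x then V (m + 1) x else stopValue V m x

/-- The indicator of the points whose cell of generation `m` is principal, that is, where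
`stopValue` is updated at generation `m`. -/
noncomputable def stopInd (V : ℕ → X → ℝ≥0∞) : ℕ → X → ℝ≥0∞
  | 0 => fun _ => 1
  | m + 1 => fun x => if 2 * stopValue V m x < V (m + 1) x then 1 else 0

variable {V : ℕ → X → ℝ≥0∞}

theorem le_two_mul_stopValue (m : ℕ) (x : X) : V m x ≤ 2 * stopValue V m x := by
  cases m with
  | zero => exact le_mul_of_one_le_left' one_le_two
  | succ k =>
    by_cases h : 2 * stopValue V k x < V (k + 1) x
    · simp only [stopValue, if_pos h]
      exact le_mul_of_one_le_left' one_le_two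
    · simpa only [stopValue, if_neg h] using not_lt.mp h

theorem stopValue_rpow_le (q : ℝ) (m : ℕ) (x : X) :
    stopValue V m x ^ q ≤ ∑ j ∈ Finset.range (m + 1), stopInd V j x * V j x ^ q := by
  induction m with
  | zero => simp [stopValue, stopInd]
  | succ k ih =>
    rw [Finset.sum_range_succ]
    by_cases h : 2 * stopValue V k x < V (k + 1) x
    · simp [stopValue, stopInd, h]
    · simpa [stopValue, stopInd, h] using ih

theorem iSup_rpow_le_tsum_stopInd {q : ℝ} (hq : 0 < q) (x : X) :
    (⨆ m, V m x) ^ q ≤ 2 ^ q * ∑' m, stopInd V m x * V m x ^ q := by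
  rw [iSup_rpow hq]
  refine iSup_le fun m => ?_
  refine (ENNReal.rpow_le_rpow (le_two_mul_stopValue m x) hq.le).trans ?_
  rw [ENNReal.mul_rpow_of_nonneg _ _ hq.le]
  exact mul_le_mul_right ((stopValue_rpow_le q m x).trans (ENNReal.sum_le_tsum _)) _

/-- The ratio of the current to the stored value pays for the principal cells. -/
theorem stopInd_add_div_le (m : ℕ) (x : X) :
    stopInd V (m + 1) x + V (m + 1) x / stopValue V (m + 1) x ≤
      V (m + 1) x / stopValue V m x := by
  by_cases h : 2 * stopValue V m x < V (m + 1) x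
  · simp only [stopInd, stopValue, h, if_true]
    have hT : stopValue V m x ≠ ∞ := by
      intro hT; simp [hT] at h
    calc (1 : ℝ≥0∞) + V (m + 1) x / V (m + 1) x ≤ 1 + 1 := by
          gcongr; exact ENNReal.div_self_le_one
      _ = 2 := one_add_one_eq_two
      _ ≤ _ := by
        rw [ENNReal.le_div_iff_mul_le (Or.inr (ne_bot_of_gt h)) (Or.inl hT)]
        exact h.le
  · simp [stopInd, stopValue, h]

theorem div_stopValue_le_two (m : ℕ) (x : X) : V m x / stopValue V m x ≤ 2 :=
  ENNReal.div_le_of_le_mul (le_two_mul_stopValue m x)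

theorem stopInd_le_one (m : ℕ) (x : X) : stopInd V m x ≤ 1 := by
  cases m with
  | zero => exact le_rfl
  | succ k => simp only [stopInd]; split_ifs <;> simp

end StoppingTime

namespace CellFiltration

variable {X ι : Type*} [MeasurableSpace X] [MeasurableSpace ι]
  {T : CellFiltration X ι} {μ ν : Measure X}

theorem adapted_stopValue {V : ℕ → X → ℝ≥0∞} (hV : ∀ m, T.Adapted m (V m)) (m : ℕ) :
    T.Adapted m (stopValue V m) := by
  induction m with
  | zero => exact hV 0
  | succ k ih =>
    exact (hV (k + 1)).comp₂ (ih.mono k.le_succ) fun a b => if 2 * b < a then a else b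

theorem adapted_stopInd {V : ℕ → X → ℝ≥0∞} (hV : ∀ m, T.Adapted m (V m)) (m : ℕ) :
    T.Adapted m (stopInd V m) := by
  cases m with
  | zero => exact adapted_const 1
  | succ k =>
    exact (hV (k + 1)).comp₂ ((adapted_stopValue hV k).mono k.le_succ)
      fun a b => if 2 * b < a then 1 else 0

variable [Countable ι] [MeasurableSingletonClass ι]

/-- The principal cells of a supermartingale satisfy a Carleson condition. The ratio
`V m / stopValue V m ≤ 2` serves as a Lyapunov function: its expectation decreases at each
generation by at least the measure of the new principal cells. -/
theorem tsum_lintegral_stopInd_le {V : ℕ → X → ℝ≥0∞} (hV : ∀ m, T.Adapted m (V m))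
    (hsuper : ∀ m (h : X → ℝ≥0∞), T.Adapted m h →
      ∫⁻ x, h x * V (m + 1) x ∂μ ≤ ∫⁻ x, h x * V m x ∂μ)
    (j : ℕ) (h : X → ℝ≥0∞) (hh : T.Adapted j h) :
    ∑' m, ∫⁻ x, h x * stopInd V (j + m) x ∂μ ≤ 3 * ∫⁻ x, h x ∂μ := by
  have hSm : ∀ m, Measurable (stopInd V m) := fun m => (adapted_stopInd hV m).measurable
  have hhm : Measurable h := hh.measurable
  -- the principal cells of `M` generations after `j`, plus the remaining ratio
  have key : ∀ M, ∑ m ∈ Finset.range M, ∫⁻ x, h x * stopInd V (j + (m + 1)) x ∂μ +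
      ∫⁻ x, h x * (V (j + M) x / stopValue V (j + M) x) ∂μ ≤
        ∫⁻ x, h x * (V j x / stopValue V j x) ∂μ := by
    intro M
    induction M with
    | zero => simp
    | succ k ih =>
      refine le_trans ?_ ih
      rw [Finset.sum_range_succ, add_assoc]
      refine add_le_add le_rfl ?_
      rw [← lintegral_add_left (hhm.fun_mul (hSm _))]
      calc ∫⁻ x, (h x * stopInd V (j + (k + 1)) x +
            h x * (V (j + (k + 1)) x / stopValue V (j + (k + 1)) x)) ∂μ
          ≤ ∫⁻ x, h x * (stopValue V (j + k) x)⁻¹ * V (j + k + 1) x ∂μ := by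
            refine lintegral_mono fun x => ?_
            rw [← mul_add, mul_assoc, ← ENNReal.div_eq_inv_mul]
            exact mul_le_mul_right (stopInd_add_div_le (j + k) x) _
        _ ≤ ∫⁻ x, h x * (stopValue V (j + k) x)⁻¹ * V (j + k) x ∂μ :=
            hsuper (j + k) _ ((hh.mono (j.le_add_right k)).comp₂
              (adapted_stopValue hV (j + k)) fun a b => a * b⁻¹)
        _ = _ := by
            refine lintegral_congr fun x => ?_
            rw [mul_assoc, ← ENNReal.div_eq_inv_mul]
  rw [tsum_eq_zero_add' ENNReal.summable, show (3 : ℝ≥0∞) = 1 + 2 by norm_num, add_mul, one_mul]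
  refine add_le_add (lintegral_mono fun x => mul_le_of_le_one_right' (stopInd_le_one _ x)) ?_
  rw [ENNReal.tsum_eq_iSup_nat]
  refine iSup_le fun M => (le_self_add.trans (key M)).trans ?_
  rw [← lintegral_const_mul _ hhm]
  refine lintegral_mono fun x => ?_
  rw [mul_comm]
  exact mul_le_mul_left (div_stopValue_le_two j x) _

/-- Doob's maximal inequality localized to a cell. -/
theorem setLIntegral_iSup_cellAvg_rpow_le {p : ℝ} (hp : 1 < p) {F : X → ℝ≥0∞}
    (hF : AEMeasurable F ν) (hfin : ∀ m x, ν (T.cell m x) ≠ ∞) (j : ℕ) (z : X) :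
    ∫⁻ x in T.cell j z, ⨆ m, T.cellAvg ν F (j + m) x ^ p ∂ν ≤
      ENNReal.ofReal p.conjExponent ^ p * ∫⁻ x in T.cell j z, F x ^ p ∂ν := by
  have hp0 : 0 < p := by linarith
  have hR := measurableSet_cell (T := T) j z
  have hdoob := lintegral_iSup_cellAvg_rpow_le (T := T.shift j) hp (hF.indicator hR)
    fun m x => hfin (j + m) x
  have hind : ∀ x, (T.cell j z).indicator F x ^ p =
      (T.cell j z).indicator (fun x => F x ^ p) x := fun x => by
    by_cases hx : x ∈ T.cell j z <;> simp [hx, hp0]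
  simp_rw [hind, lintegral_indicator hR] at hdoob
  refine le_trans ?_ ((setLIntegral_le_lintegral (T.cell j z) _).trans hdoob)
  refine setLIntegral_mono' hR fun x hx => ?_
  rw [iSup_rpow hp0]
  refine iSup_mono fun m => ENNReal.rpow_le_rpow (le_of_eq ?_) hp0.le
  have hsub : T.cell (j + m) x ⊆ T.cell j z :=
    (cell_subset (j.le_add_right m) x).trans (cell_eq hx).le
  change _ = (∫⁻ y in T.cell (j + m) x, (T.cell j z).indicator F y ∂ν) / ν (T.cell (j + m) x)
  rw [cellAvg, setLIntegral_congr_fun (measurableSet_cell _ _) fun y hy =>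
    (Set.indicator_of_mem (hsub hy) F).symm]

/-- The dyadic two weight estimate. The weights `c m` intermediate between the local testing
hypothesis `hloc`, which bounds the `u`-mass of a cell, and the maximal function hypothesis
`hmax`, which makes the principal cells of `V` a Carleson family for `σ`. -/
theorem lintegral_iSup_rpow_le {u σ : Measure X} {p q : ℝ} (hp : 1 < p) (hq : 0 < q)
    {A B : ℝ≥0∞} {V c : ℕ → X → ℝ≥0∞} {F : X → ℝ≥0∞} (hF : AEMeasurable F σ)
    (hσ : ∀ m x, σ (T.cell m x) ≠ ∞)
    (hV : ∀ m, T.Adapted m (V m)) (hc : ∀ m, T.Adapted m (c m))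
    (hsuper : ∀ m (h : X → ℝ≥0∞), T.Adapted m h →
      ∫⁻ x, h x * V (m + 1) x ∂μ ≤ ∫⁻ x, h x * V m x ∂μ)
    (hloc : ∀ m x, V m x ^ q * u (T.cell m x) ≤
      B * (T.cellAvg σ F m x ^ p * (c m x * μ (T.cell m x))))
    (hmax : ∀ j z, ∫⁻ x in T.cell j z, ⨆ m, c (j + m) x ∂μ ≤ A * σ (T.cell j z)) :
    ∫⁻ x, (⨆ m, V m x) ^ q ∂u ≤
      2 ^ q * (B * (3 * A * (ENNReal.ofReal p.conjExponent ^ p * ∫⁻ x, F x ^ p ∂σ))) := by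
  have hS : ∀ m, T.Adapted m (stopInd V m) := adapted_stopInd hV
  have hsparse := tsum_lintegral_stopInd_le (μ := μ) hV hsuper
  have hcm : ∀ m, Measurable (c m) := fun m => (hc m).measurable
  -- the principal cells, weighted with `c`, satisfy the Carleson condition on a cell
  have hcell : ∀ j z, ∫⁻ x in T.cell j z, ∑' m, stopInd V (j + m) x * c (j + m) x ∂μ ≤
      ∫⁻ x in T.cell j z, 3 * A ∂σ := by
    intro j z
    have hR : T.Adapted j ((T.cell j z).indicator (1 : X → ℝ≥0∞)) := by
      intro x y hxy
      have : x ∈ T.cell j z ↔ y ∈ T.cell j z := by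
        simp only [cell, Set.mem_preimage, Set.mem_singleton_iff, hxy]
      by_cases hx : x ∈ T.cell j z
      · simp [hx, this.mp hx]
      · simp [hx, mt this.mpr hx]
    have hcar := tsum_lintegral_mul_le (T := T.shift j) (μ := μ) (ν := μ) (A := 3)
      (c := fun m => stopInd V (j + m))
      (g := fun m x => (T.cell j z).indicator (1 : X → ℝ≥0∞) x * c (j + m) x)
      (fun m => (hS (j + m)).measurable)
      (fun m => (hR.mono (j.le_add_right m)).comp₂ (hc (j + m)) (· * ·))
      (fun i h hh => by
        simpa only [add_assoc] using hsparse (j + i) h hh)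
    have hind : ∀ (φ : X → ℝ≥0∞), ∫⁻ x, (T.cell j z).indicator (1 : X → ℝ≥0∞) x * φ x ∂μ =
        ∫⁻ x in T.cell j z, φ x ∂μ := by
      intro φ
      rw [← lintegral_indicator (measurableSet_cell j z)]
      refine lintegral_congr fun x => ?_
      by_cases hx : x ∈ T.cell j z <;> simp [hx]
    simp_rw [← ENNReal.mul_iSup, mul_assoc] at hcar
    simp_rw [hind] at hcar
    rw [lintegral_tsum fun m => ((hS (j + m)).measurable.fun_mul (hcm (j + m))).aemeasurable,
      setLIntegral_const, mul_assoc]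
    simp_rw [mul_comm (c _ _)] at hcar
    exact hcar.trans (mul_le_mul_right (hmax j z) _)
  have hcar : ∀ j (h : X → ℝ≥0∞), T.Adapted j h →
      ∑' m, ∫⁻ x, h x * (stopInd V (j + m) x * c (j + m) x) ∂μ ≤ 3 * A * ∫⁻ x, h x ∂σ := by
    intro j h hh
    have h1 := lintegral_mul_le_of_cell (T := T) (m := j) (h := h) (μ := μ) (ν := σ)
      (φ := fun x => ∑' m, stopInd V (j + m) x * c (j + m) x) (ψ := fun _ => 3 * A)
      (Measurable.tsum fun m =>
        (hS (j + m)).measurable.fun_mul (hcm (j + m))).aemeasurable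
      aemeasurable_const hh (hcell j)
    rw [← lintegral_tsum fun m => (hh.measurable.fun_mul
      ((hS (j + m)).measurable.fun_mul (hcm (j + m)))).aemeasurable]
    simp_rw [ENNReal.tsum_mul_left]
    rwa [lintegral_mul_const _ hh.measurable, mul_comm _ (3 * A)] at h1
  have hgen : ∀ m, ∫⁻ x, stopInd V m x * V m x ^ q ∂u ≤
      B * ∫⁻ x, T.cellAvg σ F m x ^ p * (stopInd V m x * c m x) ∂μ := by
    intro m
    have hVq := (hV m).comp (· ^ q)
    have hE := (adapted_cellAvg (T := T) σ F m).comp (· ^ p)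
    have hEc := hE.comp₂ (hc m) (· * ·)
    have h1 := lintegral_mul_le_of_cell (T := T) (m := m) (h := stopInd V m) (μ := u) (ν := μ)
      (φ := fun x => V m x ^ q) (ψ := fun x => B * (T.cellAvg σ F m x ^ p * c m x))
      hVq.measurable.aemeasurable (hEc.comp (B * ·)).measurable.aemeasurable (hS m) (fun x => by
        rw [setLIntegral_adapted hVq, setLIntegral_adapted (hEc.comp (B * ·))]
        simpa only [mul_assoc] using hloc m x)
    refine h1.trans (le_of_eq ?_)
    rw [← lintegral_const_mul _ (hE.measurable.fun_mul ((hS m).measurable.fun_mul (hcm m)))]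
    exact lintegral_congr fun x => by ring
  calc ∫⁻ x, (⨆ m, V m x) ^ q ∂u
      ≤ ∫⁻ x, 2 ^ q * ∑' m, stopInd V m x * V m x ^ q ∂u :=
        lintegral_mono fun x => iSup_rpow_le_tsum_stopInd hq x
    _ = 2 ^ q * ∑' m, ∫⁻ x, stopInd V m x * V m x ^ q ∂u := by
        have hmm : ∀ m, Measurable fun x => stopInd V m x * V m x ^ q :=
          fun m => (hS m).measurable.fun_mul ((hV m).measurable.pow_const q)
        rw [lintegral_const_mul _ (Measurable.tsum hmm),
          lintegral_tsum fun m => (hmm m).aemeasurable]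
    _ ≤ 2 ^ q * (B * (3 * A * ∫⁻ x, ⨆ m, T.cellAvg σ F m x ^ p ∂σ)) := by
        gcongr
        refine (ENNReal.tsum_le_tsum hgen).trans ?_
        rw [ENNReal.tsum_mul_left]
        gcongr
        exact tsum_lintegral_mul_le (fun m => (hS m).measurable.fun_mul (hcm m))
          (fun m => (adapted_cellAvg (T := T) σ F m).comp (· ^ p)) hcar
    _ ≤ _ := by
        gcongr
        have := lintegral_iSup_cellAvg_rpow_le hp hF hσ
        simpa only [iSup_rpow (lt_trans zero_lt_one hp)] using this

end CellFiltration

variable {n : ℕ}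

/-! ### Cubes -/

theorem Cube.volume_toSet (Q : Cube n) : volume Q.toSet = ENNReal.ofReal Q.side ^ n := by
  rw [Cube.toSet, Real.volume_pi_Ico]
  simp

theorem Cube.volume_ne_zero (Q : Cube n) : volume Q.toSet ≠ 0 := by
  rw [Q.volume_toSet]
  exact pow_ne_zero _ (by simpa using Q.side_pos)

theorem Cube.volume_ne_top (Q : Cube n) : volume Q.toSet ≠ ∞ := by
  rw [Q.volume_toSet]
  exact ENNReal.pow_ne_top ENNReal.ofReal_ne_top

theorem Cube.measurableSet_toSet (Q : Cube n) : MeasurableSet Q.toSet :=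
  MeasurableSet.univ_pi fun _ => measurableSet_Ico

theorem Cube.subset_isCompact (Q : Cube n) : ∃ K, IsCompact K ∧ Q.toSet ⊆ K :=
  ⟨Set.univ.pi fun i => Set.Icc (Q.corner i) (Q.corner i + Q.side),
    isCompact_univ_pi fun _ => isCompact_Icc, Set.pi_mono fun _ _ => Set.Ico_subset_Icc_self⟩

/-! ### Shifted dyadic grids -/

/-- The shift, relative to the side length, of the dyadic grid of generation `k` in one
coordinate: either none, or one third of the side length in alternating directions. The alternating
sign makes the shifted grids of successive generations nested. -/
noncomputable def gridShift (t : Bool) (k : ℤ) : ℝ := if t then (-1) ^ k / 3 else 0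

/-- The label of the cube of side `2 ^ (-k)` that contains `x`, in the grid shifted as prescribed
by `t`. -/
noncomputable def gridIndex (t : Fin n → Bool) (k : ℤ) (x : Fin n → ℝ) : Fin n → ℤ :=
  fun i => ⌊2 ^ k * x i - gridShift (t i) k⌋

/-- The cube of side `2 ^ (-k)` of the shifted grid that contains `x`. -/
noncomputable def gridCube (t : Fin n → Bool) (k : ℤ) (x : Fin n → ℝ) : Cube n where
  corner i := (gridIndex t k x i + gridShift (t i) k) / 2 ^ k
  side := 1 / 2 ^ k
  side_pos := by positivity

theorem mem_gridCube_iff {t : Fin n → Bool} {k : ℤ} {x y : Fin n → ℝ} :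
    y ∈ (gridCube t k x).toSet ↔ gridIndex t k y = gridIndex t k x := by
  have h2 : (0 : ℝ) < 2 ^ k := by positivity
  rw [Cube.toSet, Set.mem_univ_pi, funext_iff]
  refine forall_congr' fun i => ?_
  rw [gridIndex, Int.floor_eq_iff]
  simp only [gridCube, Set.mem_Ico, ← add_div]
  rw [div_le_iff₀ h2, lt_div_iff₀ h2]
  constructor <;> rintro ⟨h, h'⟩ <;> constructor <;> linarith

theorem measurable_gridIndex (t : Fin n → Bool) (k : ℤ) : Measurable (gridIndex t k) :=
  measurable_pi_lambda _ fun i =>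
    Int.measurable_floor.comp (((measurable_pi_apply i).const_mul _).sub_const _)

theorem gridIndex_nested {t : Fin n → Bool} {k : ℤ} {x y : Fin n → ℝ}
    (h : gridIndex t (k + 1) x = gridIndex t (k + 1) y) : gridIndex t k x = gridIndex t k y := by
  -- the shifts of successive generations differ by an integer in units of the smaller side
  obtain ⟨e, he⟩ : ∃ e : Bool → ℤ, ∀ b, 2 * gridShift b k - gridShift b (k + 1) = e b := by
    rcases Int.even_or_odd k with hk | hk
    · refine ⟨fun b => if b then 1 else 0, fun b => ?_⟩
      cases b
      · simp [gridShift]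
      · simp [gridShift, zpow_add₀, hk.neg_one_zpow]; norm_num
    · refine ⟨fun b => if b then -1 else 0, fun b => ?_⟩
      cases b
      · simp [gridShift]
      · simp [gridShift, zpow_add₀, hk.neg_one_zpow]; norm_num
  have key : ∀ z : Fin n → ℝ, ∀ i, gridIndex t k z i = (gridIndex t (k + 1) z i - e (t i)) / 2 := by
    intro z i
    have h1 : (2 : ℝ) ^ k * z i - gridShift (t i) k =
        ((2 : ℝ) ^ (k + 1) * z i - gridShift (t i) (k + 1) - e (t i)) / (2 : ℕ) := by
      rw [← he, zpow_add₀ two_ne_zero]; push_cast; ring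
    rw [gridIndex, h1, Int.floor_div_natCast, Int.floor_sub_intCast]
    rfl
  funext i
  rw [key, key, h]

/-- The generations `k ≥ -N` of a shifted dyadic grid: generation `m` of the filtration consists of
the grid cubes of side `2 ^ (N - m)`. -/
noncomputable def gridFiltration (t : Fin n → Bool) (N : ℕ) :
    CellFiltration (Fin n → ℝ) (Fin n → ℤ) where
  index m := gridIndex t (m - N)
  measurable_index m := measurable_gridIndex t _
  nested m x y h := gridIndex_nested (by
    rw [show ((m : ℤ) - N + 1) = ((m + 1 : ℕ) : ℤ) - N by push_cast; ring]; exact h)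

theorem cell_gridFiltration (t : Fin n → Bool) (N m : ℕ) (x : Fin n → ℝ) :
    (gridFiltration t N).cell m x = (gridCube t (m - N) x).toSet := by
  ext y
  exact mem_gridCube_iff.symm

/-- The one-third trick: an interval of length at most one third misses the endpoints of one of
the two grids of unit intervals with relative shift one third. -/
theorem exists_gridShift (k : ℤ) {a ℓ : ℝ} (hℓ : ℓ ≤ 1 / 3) :
    ∃ t, ∀ y, a ≤ y → y < a + ℓ → ⌊y - gridShift t k⌋ = ⌊a - gridShift t k⌋ := by
  by_contra! H
  obtain ⟨y, hy, hy', hne⟩ := H false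
  obtain ⟨z, hz, hz', hne'⟩ := H true
  have hlt := lt_of_le_of_ne (Int.floor_mono (sub_le_sub_right hy _)) hne.symm
  have hlt' := lt_of_le_of_ne (Int.floor_mono (sub_le_sub_right hz _)) hne'.symm
  have h1 := Int.lt_floor_add_one (a - gridShift false k)
  have h1' := Int.lt_floor_add_one (a - gridShift true k)
  have h2 : ((⌊a - gridShift false k⌋ + 1 : ℤ) : ℝ) ≤ y - gridShift false k :=
    Int.le_floor.mp hlt
  have h2' : ((⌊a - gridShift true k⌋ + 1 : ℤ) : ℝ) ≤ z - gridShift true k :=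
    Int.le_floor.mp hlt'
  set u := ⌊a - gridShift false k⌋
  set v := ⌊a - gridShift true k⌋
  push_cast at h2 h2'
  have hf : gridShift false k = 0 := by simp [gridShift]
  rw [hf] at h1 h2
  have hlo : ((u - v : ℤ) : ℝ) < gridShift true k + 1 / 3 := by push_cast; linarith
  have hhi : gridShift true k - 1 / 3 < ((u - v : ℤ) : ℝ) := by push_cast; linarith
  rcases Int.even_or_odd k with hk | hk
  · have ht : gridShift true k = 1 / 3 := by simp [gridShift, hk.neg_one_zpow]
    rw [ht] at hlo hhi
    have : u - v < 1 := by exact_mod_cast hlo.trans (by norm_num : (1 / 3 + 1 / 3 : ℝ) < 1)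
    have : 0 < u - v := by exact_mod_cast (by linarith : (0 : ℝ) < ((u - v : ℤ) : ℝ))
    omega
  · have ht : gridShift true k = -1 / 3 := by simp [gridShift, hk.neg_one_zpow]
    rw [ht] at hlo hhi
    have : u - v < 0 := by exact_mod_cast (by linarith : ((u - v : ℤ) : ℝ) < 0)
    have : -1 < u - v := by exact_mod_cast (by linarith : (-1 : ℝ) < ((u - v : ℤ) : ℝ))
    omega

/-- Every cube is contained in a cube of comparable size of one of the shifted grids. -/
theorem exists_gridCube_subset (Q : Cube n) {x : Fin n → ℝ} (hx : x ∈ Q.toSet) :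
    ∃ t k, Q.toSet ⊆ (gridCube t k x).toSet ∧ (gridCube t k x).side ≤ 6 * Q.side := by
  obtain ⟨j, hj, hj'⟩ := exists_mem_Ioc_zpow (x := 3 * Q.side) (y := (2 : ℝ))
    (by linarith [Q.side_pos]) one_lt_two
  have h2 : (0 : ℝ) < 2 ^ (-(j + 1)) := by positivity
  have hinv : (1 : ℝ) / 2 ^ (-(j + 1)) = 2 ^ (j + 1) := by rw [zpow_neg, one_div, inv_inv]
  have hℓ : 2 ^ (-(j + 1)) * Q.side ≤ 1 / 3 := by
    rw [← hinv, le_div_iff₀ h2] at hj'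
    linarith
  choose t ht using fun i : Fin n =>
    exists_gridShift (-(j + 1)) (a := 2 ^ (-(j + 1)) * Q.corner i) hℓ
  refine ⟨t, -(j + 1), fun y hy => ?_, ?_⟩
  · rw [mem_gridCube_iff]
    have key : ∀ z ∈ Q.toSet, ∀ i, gridIndex t (-(j + 1)) z i =
        ⌊2 ^ (-(j + 1)) * Q.corner i - gridShift (t i) (-(j + 1))⌋ := by
      intro z hz i
      have hzi := hz i (Set.mem_univ i)
      exact ht i _ (mul_le_mul_of_nonneg_left hzi.1 h2.le)
        (by rw [← mul_add]; exact mul_lt_mul_of_pos_left hzi.2 h2)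
    funext i
    rw [key y hy, key x hx]
  · change 1 / (2 : ℝ) ^ (-(j + 1)) ≤ _
    rw [hinv, zpow_add₀ two_ne_zero, zpow_one]
    linarith

/-! ### Reduction to dyadic maximal functions -/

/-- The fractional average of `g` over the grid cube of generation `k` that contains `x`. -/
noncomputable def gridFracAvg (α : ℝ) (g : (Fin n → ℝ) → ℝ≥0∞) (t : Fin n → Bool) (k : ℤ)
    (x : Fin n → ℝ) : ℝ≥0∞ :=
  volume (gridCube t k x).toSet ^ (α / n) * ⨍⁻ y in (gridCube t k x).toSet, g y ∂volume

theorem fracMaximal_le {α : ℝ} (hα : 0 ≤ α) (f : (Fin n → ℝ) → ℝ) (x : Fin n → ℝ) :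
    fracMaximal α f x ≤
      6 ^ n * ⨆ t : Fin n → Bool, ⨆ k, gridFracAvg α (fun y => ‖f y‖ₑ) t k x := by
  refine iSup₂_le fun Q hx => ?_
  obtain ⟨t, k, hsub, hside⟩ := exists_gridCube_subset Q hx
  set P := gridCube t k x with hP
  have hvol : volume P.toSet ≤ 6 ^ n * volume Q.toSet := by
    rw [P.volume_toSet, Q.volume_toSet, ← mul_pow]
    gcongr
    rw [show (6 : ℝ≥0∞) = ENNReal.ofReal 6 by simp, ← ENNReal.ofReal_mul (by norm_num)]
    exact ENNReal.ofReal_le_ofReal hside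
  refine le_trans ?_ (mul_le_mul_right (le_iSup₂_of_le (f := fun t k =>
    gridFracAvg α (fun y => ‖f y‖ₑ) t k x) t k le_rfl) _)
  rw [gridFracAvg, setLAverage_eq, setLAverage_eq, ← hP, mul_left_comm]
  refine mul_le_mul' (ENNReal.rpow_le_rpow (measure_mono hsub) (by positivity)) ?_
  rw [ENNReal.div_le_iff Q.volume_ne_zero Q.volume_ne_top, mul_right_comm,
    ← mul_div_assoc, ENNReal.le_div_iff_mul_le (Or.inl P.volume_ne_zero)
      (Or.inl P.volume_ne_top), mul_comm]
  exact mul_le_mul' hvol (lintegral_mono_set hsub)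

theorem gridFracAvg_eq (α : ℝ) (g : (Fin n → ℝ) → ℝ≥0∞) (t : Fin n → Bool) (N m : ℕ)
    (x : Fin n → ℝ) : gridFracAvg α g t (m - N) x =
      volume ((gridFiltration t N).cell m x) ^ (α / n) *
        (gridFiltration t N).cellAvg volume g m x := by
  rw [gridFracAvg, CellFiltration.cellAvg, cell_gridFiltration, setLAverage_eq]

theorem measurable_gridFracAvg (α : ℝ) (g : (Fin n → ℝ) → ℝ≥0∞) (t : Fin n → Bool) (k : ℤ) :
    Measurable (gridFracAvg α g t k) := by
  have hf : Function.FactorsThrough (gridFracAvg α g t k) (gridIndex t k) := by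
    intro x y h
    have : (gridCube t k x) = gridCube t k y := by simp only [gridCube, h]
    simp only [gridFracAvg, this]
  have : gridFracAvg α g t k = Function.extend (gridIndex t k) (gridFracAvg α g t k) 0 ∘
      gridIndex t k := by
    funext x; exact (hf.extend_apply 0 x).symm
  rw [this]
  exact (measurable_of_countable _).comp (measurable_gridIndex t k)

/-- A bound for the dyadic fractional maximal functions of all shifted grids, restricted to
generations bounded from below, yields a bound for the fractional maximal function. -/
theorem lintegral_fracMaximal_rpow_le {α q : ℝ} (hα : 0 ≤ α) (hq : 0 < q)
    (f : (Fin n → ℝ) → ℝ) {u : Measure (Fin n → ℝ)} {D : ℝ≥0∞}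
    (hD : ∀ (t : Fin n → Bool) (N : ℕ),
      ∫⁻ x, (⨆ m : ℕ, gridFracAvg α (fun y => ‖f y‖ₑ) t (m - N) x) ^ q ∂u ≤ D) :
    ∫⁻ x, fracMaximal α f x ^ q ∂u ≤ (6 ^ n) ^ q * (2 ^ n * D) := by
  set U := gridFracAvg α fun y => ‖f y‖ₑ with hU
  have hUm : ∀ t k, Measurable (U t k) := measurable_gridFracAvg α _
  have hN : ∀ t x, ⨆ k, U t k x = ⨆ N : ℕ, ⨆ m : ℕ, U t (m - N) x := by
    intro t x
    refine le_antisymm (iSup_le fun k => ?_)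
      (iSup_le fun N => iSup_le fun m => le_iSup (fun k => U t k x) _)
    refine le_iSup₂_of_le (f := fun N m : ℕ => U t (m - N) x) k.natAbs (k + k.natAbs).toNat ?_
    rw [show (((k + k.natAbs).toNat : ℕ) : ℤ) - (k.natAbs : ℕ) = k by omega]
  have hgrid : ∀ t, ∫⁻ x, (⨆ k, U t k x) ^ q ∂u ≤ D := by
    intro t
    -- the truncated maximal functions increase with `N`
    rw [lintegral_congr fun x => by rw [hN, iSup_rpow hq],
      lintegral_iSup fun N => (Measurable.iSup fun m => hUm t _).pow_const q]
    · exact iSup_le (hD t)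
    · intro N N' hNN x
      refine ENNReal.rpow_le_rpow (iSup_le fun m => ?_) hq.le
      refine le_iSup_of_le (f := fun m : ℕ => U t (m - N') x) (m + (N' - N)) (le_of_eq ?_)
      congr 1
      push_cast [Nat.cast_sub hNN]
      ring
  calc ∫⁻ x, fracMaximal α f x ^ q ∂u
      ≤ ∫⁻ x, (6 ^ n) ^ q * ∑ t : Fin n → Bool, (⨆ k, U t k x) ^ q ∂u := by
        refine lintegral_mono fun x => ?_
        refine (ENNReal.rpow_le_rpow (fracMaximal_le hα f x) hq.le).trans ?_
        rw [ENNReal.mul_rpow_of_nonneg _ _ hq.le]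
        refine mul_le_mul_right ?_ _
        rw [iSup_rpow hq]
        exact iSup_le fun t => Finset.single_le_sum (f := fun t => (⨆ k, U t k x) ^ q)
          (fun _ _ => zero_le) (Finset.mem_univ t)
    _ = (6 ^ n) ^ q * ∑ t : Fin n → Bool, ∫⁻ x, (⨆ k, U t k x) ^ q ∂u := by
        have hm : ∀ t, Measurable fun x => (⨆ k, U t k x) ^ q :=
          fun t => (Measurable.iSup fun k => hUm t k).pow_const q
        rw [lintegral_const_mul _ (Finset.measurable_fun_sum _ fun t _ => hm t),
          lintegral_finsetSum _ fun t _ => hm t]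
    _ ≤ (6 ^ n) ^ q * (2 ^ n * D) := by
        refine mul_le_mul_right ((Finset.sum_le_sum fun t _ => hgrid t).trans ?_) _
        simp

/-! ### Weights -/

variable {w u σ : (Fin n → ℝ) → ℝ}

theorem IsWeight.aemeasurable (hw : IsWeight w) :
    AEMeasurable (fun x => ENNReal.ofReal (w x)) volume :=
  hw.locallyIntegrable.aestronglyMeasurable.aemeasurable.ennreal_ofReal

theorem IsWeight.integrableOn (hw : IsWeight w) (Q : Cube n) : IntegrableOn w Q.toSet := by
  obtain ⟨K, hK, hQ⟩ := Q.subset_isCompact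
  exact (hw.locallyIntegrable.integrableOn_isCompact hK).mono_set hQ

theorem weightMeasure_toSet (w : (Fin n → ℝ) → ℝ) (Q : Cube n) :
    weightMeasure w Q.toSet = ∫⁻ x in Q.toSet, ENNReal.ofReal (w x) :=
  withDensity_apply _ Q.measurableSet_toSet

theorem IsWeight.weightMeasure_ne_top (hw : IsWeight w) (Q : Cube n) :
    weightMeasure w Q.toSet ≠ ∞ := by
  rw [weightMeasure_toSet]
  exact (hw.integrableOn Q).lintegral_lt_top.ne

theorem avg_eq (w : (Fin n → ℝ) → ℝ) (Q : Cube n) :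
    avg w Q = weightMeasure w Q.toSet / volume Q.toSet := by
  rw [avg, setLAverage_eq, weightMeasure_toSet]

theorem setLIntegral_weightMeasure (hw : IsWeight w) {F : (Fin n → ℝ) → ℝ≥0∞}
    (hF : AEMeasurable F (weightMeasure w)) (Q : Cube n) :
    ∫⁻ x in Q.toSet, F x ∂weightMeasure w =
      ∫⁻ x in Q.toSet, ENNReal.ofReal (w x) * F x := by
  rw [weightMeasure, restrict_withDensity Q.measurableSet_toSet,
    lintegral_withDensity_eq_lintegral_mul₀' hw.aemeasurable.restrict]
  · rfl
  · rw [← restrict_withDensity Q.measurableSet_toSet]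
    exact hF.restrict

theorem aemeasurable_mul_of_withDensity (hw : IsWeight w) {F : (Fin n → ℝ) → ℝ≥0∞}
    (hF : AEMeasurable F (weightMeasure w)) :
    AEMeasurable (fun x => ENNReal.ofReal (w x) * F x) volume :=
  (aemeasurable_withDensity_ennreal_iff'
    hw.locallyIntegrable.aestronglyMeasurable.aemeasurable.real_toNNReal).mp hF

/-- The exponents in `A^α_{p,q}` are made for this identity. When `X` is the average over `Q` of
some `F` with respect to `σ`, the left side is the fractional average of `F σ`, to the power `q`,
times `u(Q)`. -/
theorem fracAvg_rpow_mul_eq {α p q : ℝ} (hp : 1 < p) (hq : 0 < q) (Q : Cube n)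
    (X : ℝ≥0∞) :
    (volume Q.toSet ^ (α / n) * (X * weightMeasure σ Q.toSet / volume Q.toSet)) ^ q *
        weightMeasure u Q.toSet =
      apqLocal α p q u σ Q ^ q * (X ^ p * weightMeasure σ Q.toSet) ^ (q / p) := by
  have hpq := Real.HolderConjugate.conjExponent hp
  have hp0 : 0 < p := by linarith
  rw [apqLocal, avg_eq, avg_eq]
  have hv0 := Q.volume_ne_zero
  have hvt := Q.volume_ne_top
  set v := volume Q.toSet
  set s := weightMeasure σ Q.toSet
  set U := weightMeasure u Q.toSet
  simp only [ENNReal.mul_rpow_of_nonneg _ _ hq.le, ENNReal.div_rpow_of_nonneg _ _ hq.le,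
    ENNReal.mul_rpow_of_nonneg _ _ (div_pos hq hp0).le, ← ENNReal.rpow_mul]
  rw [one_div_mul_cancel hq.ne', ENNReal.rpow_one, mul_div_cancel₀ q hp0.ne',
    ENNReal.div_rpow_of_nonneg s v
      (mul_nonneg (one_div_nonneg.mpr hpq.symm.nonneg) hq.le)]
  have hinv : 1 / p.conjExponent = 1 - 1 / p := by
    have := hpq.inv_add_inv_eq_one
    simp only [one_div]; linarith
  have hle : 0 ≤ 1 - 1 / p := hinv ▸ one_div_nonneg.mpr hpq.symm.nonneg
  rw [hinv]
  have e1 : s ^ q = s ^ ((1 - 1 / p) * q) * s ^ (q / p) := by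
    rw [← ENNReal.rpow_add_of_nonneg _ _ (mul_nonneg hle hq.le) (div_pos hq hp0).le]
    congr 1; field_simp; ring
  have e2 : v ^ (α / n * q) * (v ^ q)⁻¹ =
      v ^ ((α / n + 1 / q - 1 / p) * q) * v⁻¹ * (v ^ ((1 - 1 / p) * q))⁻¹ := by
    rw [← ENNReal.rpow_neg, ← ENNReal.rpow_neg, ← ENNReal.rpow_neg_one v,
      ← ENNReal.rpow_add _ _ hv0 hvt, ← ENNReal.rpow_add _ _ hv0 hvt,
      ← ENNReal.rpow_add _ _ hv0 hvt]
    congr 1; field_simp; ring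
  simp only [div_eq_mul_inv]
  simp only [div_eq_mul_inv] at e1 e2
  calc _ = (v ^ (α * (↑n)⁻¹ * q) * (v ^ q)⁻¹) * X ^ q * s ^ q * U := by ring
    _ = _ := by rw [e2, e1]; ring

/-! ### The exponential constant -/

theorem IsWeight.lintegral_rpow_half_ne_top (hw : IsWeight w) (Q : Cube n) :
    ∫⁻ x in Q.toSet, ENNReal.ofReal (w x) ^ (1 / 2 : ℝ) ≠ ∞ := by
  have hle : ∀ a : ℝ≥0∞, a ^ (1 / 2 : ℝ) ≤ 1 + a := by
    intro a
    rcases le_total a 1 with h | h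
    · exact (ENNReal.rpow_le_one h (by norm_num)).trans le_self_add
    · refine le_trans ?_ le_add_self
      simpa using ENNReal.rpow_le_rpow_of_exponent_le h (by norm_num : (1 / 2 : ℝ) ≤ 1)
  refine ne_top_of_le_ne_top ?_ (lintegral_mono fun x => hle _)
  rw [lintegral_add_left measurable_const, ← weightMeasure_toSet]
  simpa using ⟨Q.volume_ne_top, hw.weightMeasure_ne_top Q⟩

theorem toENNReal_log_ofReal {r : ℝ} (hr : 0 < r) :
    (ENNReal.log (ENNReal.ofReal r)).toENNReal = ENNReal.ofReal (Real.log r) ∧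
      (-ENNReal.log (ENNReal.ofReal r)).toENNReal = ENNReal.ofReal (-Real.log r) := by
  have h : ENNReal.log (ENNReal.ofReal r) = ((Real.log r : ℝ) : EReal) := by
    rw [ENNReal.log_ofReal_of_pos hr]
  rw [h, ← EReal.coe_neg]
  constructor
  · rw [EReal.toENNReal_of_ne_top (EReal.coe_ne_top _), EReal.toReal_coe]
  · rw [EReal.toENNReal_of_ne_top (EReal.coe_ne_top _), EReal.toReal_coe]

/-- Jensen's inequality: a geometric mean is at most the power mean of exponent one half. -/
theorem exp_avgLog_le (hw : IsWeight w) (Q : Cube n) :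
    EReal.exp (avgLog w Q) ≤
      ((∫⁻ x in Q.toSet, ENNReal.ofReal (w x) ^ (1 / 2 : ℝ)) / volume Q.toSet) ^ (2 : ℝ) := by
  set ν : Measure (Fin n → ℝ) := (volume Q.toSet)⁻¹ • volume.restrict Q.toSet with hν
  have hprob : IsProbabilityMeasure ν := ⟨by
    simp [hν, ENNReal.inv_mul_cancel Q.volume_ne_zero Q.volume_ne_top]⟩
  have hlav : ∀ φ : (Fin n → ℝ) → ℝ≥0∞,
      ⨍⁻ x in Q.toSet, φ x ∂volume = ∫⁻ x, φ x ∂ν := fun φ => by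
    rw [laverage, hν, Measure.restrict_apply_univ]
  have hac : ν ≪ volume := Measure.smul_absolutelyContinuous.trans
    Measure.restrict_le_self.absolutelyContinuous
  have hwm : AEMeasurable w ν :=
    hw.locallyIntegrable.aestronglyMeasurable.aemeasurable.mono_ac hac
  have hwi : Integrable w ν :=
    (hw.integrableOn Q).smul_measure (ENNReal.inv_ne_top.mpr Q.volume_ne_zero)
  rw [← setLAverage_eq, hlav, avgLog, hlav, hlav]
  -- if the negative part has infinite average, the geometric mean is `exp (-∞) = 0`
  by_cases hN : ∫⁻ x, (-ENNReal.log (ENNReal.ofReal (w x))).toENNReal ∂ν = ∞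
  · rw [hN, EReal.coe_ennreal_top, EReal.sub_top]
    simp
  have hNm : AEMeasurable (fun x => (-ENNReal.log (ENNReal.ofReal (w x))).toENNReal) ν :=
    (measurable_ereal_toENNReal.comp
      (measurable_neg.comp (ENNReal.measurable_log))).comp_aemeasurable hwm.ennreal_ofReal
  have hpos : ∀ᵐ x ∂ν, 0 < w x := by
    filter_upwards [ae_lt_top' hNm hN] with x hx
    by_contra h
    rw [ENNReal.ofReal_eq_zero.mpr (not_lt.mp h)] at hx
    simp at hx
  have eP : ∫⁻ x, (ENNReal.log (ENNReal.ofReal (w x))).toENNReal ∂ν =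
      ∫⁻ x, ENNReal.ofReal (Real.log (w x)) ∂ν :=
    lintegral_congr_ae (hpos.mono fun x hx => (toENNReal_log_ofReal hx).1)
  have eN : ∫⁻ x, (-ENNReal.log (ENNReal.ofReal (w x))).toENNReal ∂ν =
      ∫⁻ x, ENNReal.ofReal (-Real.log (w x)) ∂ν :=
    lintegral_congr_ae (hpos.mono fun x hx => (toENNReal_log_ofReal hx).2)
  rw [eN] at hN
  rw [eP, eN]
  have hP : ∫⁻ x, ENNReal.ofReal (Real.log (w x)) ∂ν ≠ ∞ := by
    refine ne_top_of_le_ne_top hwi.lintegral_lt_top.ne (lintegral_mono_ae ?_)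
    filter_upwards [hpos] with x hx
    exact ENNReal.ofReal_le_ofReal ((Real.log_le_sub_one_of_pos hx).trans (by linarith))
  have hlm : AEStronglyMeasurable (fun x => Real.log (w x)) ν :=
    (Real.measurable_log.comp_aemeasurable hwm).aestronglyMeasurable
  have hli : Integrable (fun x => Real.log (w x)) ν := by
    refine ⟨hlm, ?_⟩
    have habs : ∀ x, ‖Real.log (w x)‖ₑ ≤
        ENNReal.ofReal (Real.log (w x)) + ENNReal.ofReal (-Real.log (w x)) := by
      intro x
      rw [Real.enorm_eq_ofReal_abs]
      rcases abs_cases (Real.log (w x)) with ⟨h, -⟩ | ⟨h, -⟩ <;> rw [h]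
      · exact le_self_add
      · exact le_add_self
    refine lt_of_le_of_lt (lintegral_mono habs) ?_
    rw [lintegral_add_left' hlm.aemeasurable.ennreal_ofReal]
    exact ENNReal.add_lt_top.mpr ⟨lt_top_iff_ne_top.mpr hP, lt_top_iff_ne_top.mpr hN⟩
  have hL : ((∫⁻ x, ENNReal.ofReal (Real.log (w x)) ∂ν : ℝ≥0∞) : EReal) -
      ((∫⁻ x, ENNReal.ofReal (-Real.log (w x)) ∂ν : ℝ≥0∞) : EReal) =
        ((∫ x, Real.log (w x) ∂ν : ℝ) : EReal) := by
    rw [integral_eq_lintegral_pos_part_sub_lintegral_neg_part hli, EReal.coe_sub,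
      EReal.coe_ennreal_toReal hP, EReal.coe_ennreal_toReal hN]
  have hexp : ∀ᵐ x ∂ν, ENNReal.ofReal (Real.exp (Real.log (w x) / 2)) =
      ENNReal.ofReal (w x) ^ (1 / 2 : ℝ) := by
    filter_upwards [hpos] with x hx
    rw [ENNReal.ofReal_rpow_of_pos hx, Real.rpow_def_of_pos hx]
    congr 2; ring
  have hfin : ∫⁻ x, ENNReal.ofReal (w x) ^ (1 / 2 : ℝ) ∂ν ≠ ∞ := by
    rw [← hlav, setLAverage_eq]
    exact ENNReal.div_ne_top (hw.lintegral_rpow_half_ne_top Q) Q.volume_ne_zero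
  have hem : AEStronglyMeasurable (fun x => Real.exp (Real.log (w x) / 2)) ν :=
    (Real.measurable_exp.comp_aemeasurable
      ((Real.measurable_log.comp_aemeasurable hwm).div_const 2)).aestronglyMeasurable
  have hei : Integrable (fun x => Real.exp (Real.log (w x) / 2)) ν := by
    refine ⟨hem, (hasFiniteIntegral_iff_ofReal (.of_forall fun x => (Real.exp_pos _).le)).mpr ?_⟩
    rw [lintegral_congr_ae hexp]
    exact lt_top_iff_ne_top.mpr hfin
  have hjensen := convexOn_exp.map_integral_le Real.continuous_exp.continuousOn isClosed_univ
    (.of_forall fun x => Set.mem_univ (Real.log (w x) / 2)) (hli.div_const 2) hei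
  rw [hL, EReal.exp_coe, ← lintegral_congr_ae hexp,
    ← ofReal_integral_eq_lintegral_ofReal hei (.of_forall fun x => (Real.exp_pos _).le)]
  rw [integral_div] at hjensen
  have hsq : Real.exp (∫ x, Real.log (w x) ∂ν) = Real.exp ((∫ x, Real.log (w x) ∂ν) / 2) ^ 2 := by
    rw [← Real.exp_nat_mul]; congr 1; push_cast; ring
  rw [hsq, ENNReal.ofReal_pow (Real.exp_pos _).le, ENNReal.rpow_two]
  gcongr

theorem exp_avgLog_ne_top (hw : IsWeight w) (Q : Cube n) : EReal.exp (avgLog w Q) ≠ ∞ :=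
  ne_top_of_le_ne_top (ENNReal.rpow_ne_top_of_nonneg (by norm_num) (ENNReal.div_ne_top
    (hw.lintegral_rpow_half_ne_top Q) Q.volume_ne_zero)) (exp_avgLog_le hw Q)

theorem apqLocal_rpow_mul_le_mixedConst {α p q : ℝ} (hq : 0 < q) (hσ : IsWeight σ)
    (hσA : MemAInfty σ) (Q : Cube n) :
    apqLocal α p q u σ Q ^ q * weightMeasure σ Q.toSet ≤
      mixedConst α p q u σ ^ q * (EReal.exp (avgLog σ Q) * volume Q.toSet) := by
  by_cases hs : weightMeasure σ Q.toSet = 0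
  · simp [hs]
  have hv0 := Q.volume_ne_zero
  have hvt := Q.volume_ne_top
  have hlt : aexpLocal σ Q ≠ ∞ :=
    ((le_iSup (fun Q => aexpLocal σ Q) Q).trans_lt hσA).ne
  -- a vanishing geometric mean would make `A^exp_∞(σ, Q)` infinite
  have he0 : EReal.exp (avgLog σ Q) ≠ 0 := by
    intro h
    apply hlt
    rw [aexpLocal, EReal.exp_neg, h, ENNReal.inv_zero, ENNReal.mul_top]
    rw [avg_eq]
    exact (ENNReal.div_pos hs hvt).ne'
  have het := exp_avgLog_ne_top hσ Q
  have hmain : weightMeasure σ Q.toSet =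
      aexpLocal σ Q * (EReal.exp (avgLog σ Q) * volume Q.toSet) := by
    rw [aexpLocal, EReal.exp_neg, avg_eq, mul_assoc, ← mul_assoc _ _ (volume Q.toSet),
      ENNReal.inv_mul_cancel he0 het, one_mul, ENNReal.div_mul_cancel hv0 hvt]
  have hsup : apqLocal α p q u σ Q ^ q * aexpLocal σ Q ≤ mixedConst α p q u σ ^ q := by
    have := ENNReal.rpow_le_rpow (le_iSup
      (fun Q => apqLocal α p q u σ Q * aexpLocal σ Q ^ (1 / q)) Q) hq.le
    rwa [ENNReal.mul_rpow_of_nonneg _ _ hq.le, ← ENNReal.rpow_mul, one_div_mul_cancel hq.ne',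
      ENNReal.rpow_one] at this
  calc _ = apqLocal α p q u σ Q ^ q * aexpLocal σ Q *
        (EReal.exp (avgLog σ Q) * volume Q.toSet) := by
        rw [mul_assoc, ← hmain]
    _ ≤ _ := mul_le_mul_left hsup _

/-! ### The norm inequalities -/

/-- The fractional averages decrease in expectation from one generation to the next, because the
averages form a martingale and the factor `|Q| ^ (α / n)` decreases. -/
theorem gridFracAvg_supermartingale {α : ℝ} (hα : 0 ≤ α) {g : (Fin n → ℝ) → ℝ≥0∞}
    (hg : AEMeasurable g volume) (t : Fin n → Bool) (N m : ℕ) {h : (Fin n → ℝ) → ℝ≥0∞}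
    (hh : (gridFiltration t N).Adapted m h) :
    ∫⁻ x, h x * gridFracAvg α g t ((m + 1 : ℕ) - N) x ≤
      ∫⁻ x, h x * gridFracAvg α g t (m - N) x := by
  set T : CellFiltration (Fin n → ℝ) (Fin n → ℤ) := gridFiltration t N with hT
  have hfin : ∀ m x, volume (T.cell m x) ≠ ∞ := fun m x => by
    rw [hT, cell_gridFiltration]; exact Cube.volume_ne_top _
  set k : (Fin n → ℝ) → ℝ≥0∞ := fun x => h x * volume (T.cell m x) ^ (α / n) with hk
  have hka : T.Adapted m k :=
    hh.comp₂ (CellFiltration.adapted_cell (T := T) m) fun a s => a * volume s ^ (α / n)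
  simp_rw [gridFracAvg_eq, ← hT]
  calc ∫⁻ x, h x * (volume (T.cell (m + 1) x) ^ (α / n) * T.cellAvg volume g (m + 1) x)
      ≤ ∫⁻ x, k x * T.cellAvg volume g (m + 1) x := by
        refine lintegral_mono fun x => ?_
        rw [hk, ← mul_assoc]
        exact mul_le_mul_left (mul_le_mul_right (ENNReal.rpow_le_rpow (measure_mono
          (CellFiltration.cell_subset m.le_succ x)) (by positivity)) _) _
    _ = ∫⁻ x, k x * T.cellAvg volume g m x := by
        rw [CellFiltration.lintegral_mul_cellAvg hg (hfin _) (hka.mono m.le_succ),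
          CellFiltration.lintegral_mul_cellAvg hg (hfin _) hka]
    _ = _ := lintegral_congr fun x => mul_assoc _ _ _

/-- The constant in the norm inequality for the fractional maximal function. -/
noncomputable def normConst (n : ℕ) (p q : ℝ) : ℝ≥0∞ :=
  ((6 ^ n) ^ q * (2 ^ n * (2 ^ q * (3 * ENNReal.ofReal p.conjExponent ^ p)))) ^ (1 / q)

/-- The common part of both norm inequalities. The numbers `c Q |Q|` serve as Carleson weights:
they dominate `σ(Q)` after multiplication with the two weight functional, and the maximal
function of `c` is bounded on each cube by `A σ(Q)`. -/
theorem fracMaximalNorm_le {α p q : ℝ} (hα : 0 ≤ α) (hp : 1 < p) (hpq : p ≤ q)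
    (hσ : IsWeight σ) {A K : ℝ≥0∞} (c : Cube n → ℝ≥0∞)
    (hloc : ∀ Q : Cube n, apqLocal α p q u σ Q ^ q * weightMeasure σ Q.toSet ≤
      K ^ q * (c Q * volume Q.toSet))
    (hmax : ∀ (t : Fin n → Bool) (N j : ℕ) (z : Fin n → ℝ),
      ∫⁻ x in (gridFiltration t N).cell j z, ⨆ m : ℕ, c (gridCube t ((j + m : ℕ) - N) x) ≤
        A * weightMeasure σ ((gridFiltration t N).cell j z)) :
    fracMaximalNorm α p q u σ ≤ normConst n p q * (K * A ^ (1 / q)) := by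
  have hp0 : 0 < p := by linarith
  have hq0 : 0 < q := by linarith
  refine sInf_le fun f hf => ?_
  set F : (Fin n → ℝ) → ℝ≥0∞ := fun x => ‖f x‖ₑ with hFdef
  have hF : AEMeasurable F (weightMeasure σ) := hf.1.enorm
  set Φ := ∫⁻ x, F x ^ p ∂weightMeasure σ with hΦ
  set g : (Fin n → ℝ) → ℝ≥0∞ := fun x => ‖f x * σ x‖ₑ with hgdef
  have hgF : ∀ x, g x = ENNReal.ofReal (σ x) * F x := fun x => by
    rw [hgdef, hFdef]
    simp only [enorm_mul, Real.enorm_of_nonneg (hσ.nonneg x)]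
    exact mul_comm _ _
  have hgm : AEMeasurable g volume := by
    rw [funext hgF]
    exact aemeasurable_mul_of_withDensity hσ hF
  have hD : ∀ (t : Fin n → Bool) (N : ℕ),
      ∫⁻ x, (⨆ m : ℕ, gridFracAvg α g t (m - N) x) ^ q ∂weightMeasure u ≤
        2 ^ q * (K ^ q * Φ ^ (q / p - 1) *
          (3 * A * (ENNReal.ofReal p.conjExponent ^ p * Φ))) := by
    intro t N
    have hfin : ∀ m x, weightMeasure σ ((gridFiltration t N).cell m x) ≠ ∞ := fun m x => by
      rw [cell_gridFiltration]; exact hσ.weightMeasure_ne_top _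
    have hcube : ∀ m x y, (gridFiltration t N).index m x = (gridFiltration t N).index m y →
        gridCube t (m - N) x = gridCube t (m - N) y := fun m x y h => by
      simp only [gridCube, show gridIndex t (m - N) x = gridIndex t (m - N) y from h]
    refine CellFiltration.lintegral_iSup_rpow_le (T := gridFiltration t N) (μ := volume)
      (c := fun m x => c (gridCube t (m - N) x)) hp hq0 hF hfin ?_ ?_ ?_ ?_ (hmax t N)
    · intro m x y h
      simp only [gridFracAvg, hcube m x y h]
    · intro m x y h
      simp only [hcube m x y h]
    · intro m h hh
      exact gridFracAvg_supermartingale hα hgm t N m hh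
    · intro m x
      have hX := (CellFiltration.cellAvg_rpow_mul_le hp hF (hfin m) x).trans
        (setLIntegral_le_lintegral _ _)
      have hcancel : (gridFiltration t N).cellAvg (weightMeasure σ) F m x *
          weightMeasure σ ((gridFiltration t N).cell m x) =
            ∫⁻ y in (gridFiltration t N).cell m x, F y ∂weightMeasure σ := by
        rw [← CellFiltration.setLIntegral_adapted
          (CellFiltration.adapted_cellAvg (weightMeasure σ) F m),
          CellFiltration.setLIntegral_cellAvg (hfin m)]
      set X := (gridFiltration t N).cellAvg (weightMeasure σ) F m x
      rw [cell_gridFiltration] at hX hcancel ⊢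
      set Q := gridCube t (m - N) x with hQ
      have hV : gridFracAvg α g t (m - N) x =
          volume Q.toSet ^ (α / n) * (X * weightMeasure σ Q.toSet / volume Q.toSet) := by
        rw [hcancel, gridFracAvg, setLAverage_eq, setLIntegral_weightMeasure hσ hF]
        simp_rw [← hgF]
        rfl
      set s := weightMeasure σ Q.toSet
      rw [hV, fracAvg_rpow_mul_eq hp hq0]
      -- the surplus `q / p - 1 ≥ 0` of the exponent goes into the full norm of `f`
      have hpow : (X ^ p * s) ^ (q / p) ≤ X ^ p * s * Φ ^ (q / p - 1) := by
        have h1 : 0 ≤ q / p - 1 := by rw [sub_nonneg, one_le_div hp0]; exact hpq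
        calc (X ^ p * s) ^ (q / p) = (X ^ p * s) ^ (1 + (q / p - 1)) := by ring_nf
          _ = (X ^ p * s) * (X ^ p * s) ^ (q / p - 1) := by
            rw [ENNReal.rpow_add_of_nonneg _ _ zero_le_one h1, ENNReal.rpow_one]
          _ ≤ _ := by gcongr
      calc apqLocal α p q u σ Q ^ q * (X ^ p * s) ^ (q / p)
          ≤ apqLocal α p q u σ Q ^ q * (X ^ p * s * Φ ^ (q / p - 1)) := by gcongr
        _ = apqLocal α p q u σ Q ^ q * s * (X ^ p * Φ ^ (q / p - 1)) := by ring
        _ ≤ K ^ q * (c Q * volume Q.toSet) * (X ^ p * Φ ^ (q / p - 1)) := by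
          exact mul_le_mul_left (hloc Q) _
        _ = _ := by ring
  have hmain := lintegral_fracMaximal_rpow_le hα hq0 (fun x => f x * σ x) hD
  have hnorm : ∀ {r : ℝ}, 0 < r → ∀ {E : Type} [TopologicalSpace E] [ContinuousENorm E]
      (φ : (Fin n → ℝ) → E) (ν : Measure (Fin n → ℝ)),
      eLpNorm φ (ENNReal.ofReal r) ν = (∫⁻ x, ‖φ x‖ₑ ^ r ∂ν) ^ (1 / r) := by
    intro r hr E _ _ φ ν
    rw [eLpNorm_eq_lintegral_rpow_enorm_toReal (by simpa using hr) ENNReal.ofReal_ne_top,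
      ENNReal.toReal_ofReal hr.le]
  rw [hnorm hq0, hnorm hp0]
  simp only [enorm_eq_self]
  change _ ≤ _ * Φ ^ (1 / p)
  have hΦe : Φ ^ (q / p - 1) * Φ = Φ ^ (q / p) := by
    have h1 : 0 ≤ q / p - 1 := by rw [sub_nonneg, one_le_div hp0]; exact hpq
    nth_rw 2 [← ENNReal.rpow_one Φ]
    rw [← ENNReal.rpow_add_of_nonneg _ _ h1 zero_le_one, sub_add_cancel]
  have hq1 : 0 ≤ 1 / q := by positivity
  refine (ENNReal.rpow_le_rpow hmain hq1).trans (le_of_eq ?_)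
  calc ((6 ^ n) ^ q * (2 ^ n * (2 ^ q * (K ^ q * Φ ^ (q / p - 1) *
          (3 * A * (ENNReal.ofReal p.conjExponent ^ p * Φ)))))) ^ (1 / q)
      = (((6 ^ n) ^ q * (2 ^ n * (2 ^ q * (3 * ENNReal.ofReal p.conjExponent ^ p)))) *
          (K ^ q * A * Φ ^ (q / p))) ^ (1 / q) := by
        rw [← hΦe]; congr 1; ring
    _ = _ := by
        rw [ENNReal.mul_rpow_of_nonneg _ (K ^ q * A * Φ ^ (q / p)) hq1,
          ENNReal.mul_rpow_of_nonneg _ (Φ ^ (q / p)) hq1,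
          ENNReal.mul_rpow_of_nonneg (K ^ q) A hq1, ← ENNReal.rpow_mul, ← ENNReal.rpow_mul,
          mul_one_div_cancel hq0.ne', ENNReal.rpow_one, normConst, mul_assoc,
          show q / p * (1 / q) = 1 / p by field_simp]
        ring

theorem normConst_ne_top (n : ℕ) (p : ℝ) {q : ℝ} (hp : 1 < p) (hq : 0 < q) :
    normConst n p q ≠ ∞ := by
  have h6 : ((6 : ℝ≥0∞) ^ n) ^ q ≠ ∞ := ENNReal.rpow_ne_top_of_nonneg hq.le (by finiteness)
  have h2 : (2 : ℝ≥0∞) ^ q ≠ ∞ := ENNReal.rpow_ne_top_of_nonneg hq.le (by finiteness)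
  have h3 : ENNReal.ofReal p.conjExponent ^ p ≠ ∞ :=
    ENNReal.rpow_ne_top_of_nonneg (by linarith) ENNReal.ofReal_ne_top
  exact ENNReal.rpow_ne_top_of_nonneg (by positivity) (by finiteness)

theorem fracMaximalNorm_le_mixedConst {α p q : ℝ} (hα : 0 ≤ α) (hp : 1 < p) (hpq : p ≤ q)
    (hσ : IsWeight σ) (hσA : MemAInfty σ) :
    fracMaximalNorm α p q u σ ≤
      normConst n p q * (mixedConst α p q u σ * 4 ^ (1 / q)) := by
  refine fracMaximalNorm_le hα hp hpq hσ (fun Q => EReal.exp (avgLog σ Q))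
    (apqLocal_rpow_mul_le_mixedConst (by linarith) hσ hσA) fun t N j z => ?_
  have hfin : ∀ m x, volume ((gridFiltration (n := n) t N).cell m x) ≠ ∞ := fun m x => by
    rw [cell_gridFiltration]; exact Cube.volume_ne_top _
  have hdoob := CellFiltration.setLIntegral_iSup_cellAvg_rpow_le (T := gridFiltration t N)
    one_lt_two (hσ.aemeasurable.pow_const (1 / 2 : ℝ)) hfin j z
  have h4 : ENNReal.ofReal (Real.conjExponent 2) ^ (2 : ℝ) = 4 := by
    rw [Real.conjExponent, show (2 : ℝ) / (2 - 1) = 2 by norm_num, ENNReal.rpow_two]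
    norm_num
  rw [h4] at hdoob
  simp_rw [← ENNReal.rpow_mul, one_div_mul_cancel (two_ne_zero' ℝ), ENNReal.rpow_one] at hdoob
  rw [cell_gridFiltration, weightMeasure_toSet, ← cell_gridFiltration]
  refine (lintegral_mono fun x => iSup_mono fun m => ?_).trans hdoob
  rw [CellFiltration.cellAvg, cell_gridFiltration]
  exact exp_avgLog_le hσ _

theorem setLIntegral_hlMaximal_le (hσ : IsWeight σ) (Q : Cube n) :
    ∫⁻ x in Q.toSet, hlMaximal (Q.toSet.indicator σ) x ≤
      amConst σ * weightMeasure σ Q.toSet := by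
  by_cases h0 : weightMeasure σ Q.toSet = 0
  · -- here `σ = 0` almost everywhere on `Q`, and the quotient in `amConst` carries no information
    have hz : ∫⁻ y, ‖Q.toSet.indicator σ y‖ₑ = 0 := by
      rw [← h0, weightMeasure_toSet, ← lintegral_indicator Q.measurableSet_toSet]
      refine lintegral_congr fun y => ?_
      by_cases hy : y ∈ Q.toSet <;> simp [hy, Real.enorm_of_nonneg (hσ.nonneg y)]
    have hM : ∀ x, hlMaximal (Q.toSet.indicator σ) x = 0 := by
      intro x
      simp only [hlMaximal, ENNReal.iSup_eq_zero]
      intro P _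
      rw [setLAverage_eq, le_antisymm ((setLIntegral_le_lintegral _ _).trans hz.le) zero_le,
        ENNReal.zero_div]
    simp [hM]
  · rw [← ENNReal.div_le_iff h0 (hσ.weightMeasure_ne_top Q)]
    exact le_iSup (fun Q : Cube n => (∫⁻ x in Q.toSet, hlMaximal (Q.toSet.indicator σ) x) /
      weightMeasure σ Q.toSet) Q

theorem fracMaximalNorm_le_apqConst_mul {α p q : ℝ} (hα : 0 ≤ α) (hp : 1 < p) (hpq : p ≤ q)
    (hσ : IsWeight σ) :
    fracMaximalNorm α p q u σ ≤
      normConst n p q * (apqConst α p q u σ * amConst σ ^ (1 / q)) := by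
  have hq : 0 < q := by linarith
  refine fracMaximalNorm_le hα hp hpq hσ (avg σ) (fun Q => ?_) fun t N j z => ?_
  · rw [avg_eq, ENNReal.div_mul_cancel Q.volume_ne_zero Q.volume_ne_top]
    gcongr
    exact le_iSup (fun Q => apqLocal α p q u σ Q) Q
  · have hR := CellFiltration.measurableSet_cell (T := gridFiltration t N) j z
    have hsub : ∀ x ∈ (gridFiltration t N).cell j z, ∀ m,
        (gridFiltration t N).cell (j + m) x ⊆ (gridFiltration t N).cell j z := fun x hx m =>
      (CellFiltration.cell_subset (j.le_add_right m) x).trans (CellFiltration.cell_eq hx).le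
    simp_rw [cell_gridFiltration] at hR hsub ⊢
    refine le_trans (setLIntegral_mono' hR fun x hx => iSup_le fun m => ?_)
      (setLIntegral_hlMaximal_le hσ _)
    refine le_iSup₂_of_le (f := fun (Q : Cube n) (_ : x ∈ Q.toSet) => ⨍⁻ y in Q.toSet,
      ‖(gridCube t (j - N) z).toSet.indicator σ y‖ₑ ∂volume)
      (gridCube t ((j + m : ℕ) - N) x) (mem_gridCube_iff.mpr rfl) (le_of_eq ?_)
    rw [avg, setLAverage_eq, setLAverage_eq]
    congr 1
    refine setLIntegral_congr_fun (Cube.measurableSet_toSet _) fun y hy => ?_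
    rw [Set.indicator_of_mem (hsub x hx m hy), Real.enorm_of_nonneg (hσ.nonneg y)]

end TwoWeight

theorem mainTheorem2 (n : ℕ) (α p q : ℝ) (hα : 0 < α) (hαn : α < n) (hp : 1 < p) (hpq : p ≤ q) :
    ∃ C : ℝ≥0, ∀ u σ : (Fin n → ℝ) → ℝ, TwoWeight.IsWeight u → TwoWeight.IsWeight σ →
      TwoWeight.MemApq α p q u σ → TwoWeight.MemAInfty σ →
        TwoWeight.fracMaximalNorm α p q u σ ≤ C * TwoWeight.mixedConst α p q u σ ∧
        TwoWeight.fracMaximalNorm α p q u σ ≤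
          C * (TwoWeight.apqConst α p q u σ * TwoWeight.amConst σ ^ (1 / q)) := by
  have hq : 0 < q := by linarith
  have h4 : (4 : ℝ≥0∞) ^ (1 / q) ≠ ∞ := ENNReal.rpow_ne_top_of_nonneg (by positivity) (by simp)
  have h4' : (1 : ℝ≥0∞) ≤ 4 ^ (1 / q) := ENNReal.one_le_rpow (by norm_num) (by positivity)
  have hC := ENNReal.mul_ne_top (TwoWeight.normConst_ne_top n p hp hq) h4
  refine ⟨(TwoWeight.normConst n p q * 4 ^ (1 / q)).toNNReal, fun u σ _ hσ _ hσA => ?_⟩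
  rw [ENNReal.coe_toNNReal hC]
  constructor
  · refine (TwoWeight.fracMaximalNorm_le_mixedConst hα.le hp hpq hσ hσA).trans (le_of_eq ?_)
    ring
  · refine (TwoWeight.fracMaximalNorm_le_apqConst_mul hα.le hp hpq hσ).trans ?_
    gcongr
    exact le_mul_of_one_le_right' h4'
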